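/- **Setting.** Let $d,T\ge 1$, let $\mathbb B^d=\{x\in\mathbb R^d:\|x\|_2\le 1\}$ and let $\theta^\ast\in\mathbb B^d$. On a probability space with a filtration $(\mathcal F_t)_{t\ge 0}$, in each round $t=1,\dots,T$ an agent plays an $\mathcal F_{t-1}$-measurable action $x_t\in\mathbb B^d$ and then observes $r_t=\langle x_t,\theta^\ast\rangle+\eta_t$ together with $\sigma_t^2$, where $\eta_t$ is $\mathcal F_t$-measurable and $\sigma_t\ge 0$ is $\mathcal F_{t-1}$-measurable. The noise is * conditionally symmetric: given $\mathcal F_{t-1}$, $\eta_t$ and $-\eta_t$ have the same conditional law; * conditionally sub-Gaussian with variance proxy $\sigma_t^2$: almost surely $\mathbb E[\exp(l(\eta_t-\mathbb E[\eta_t\mid\mathcal F_{t-1}]))\mid\mathcal F_{t-1}]\le\exp(\tfrac12 l^2\sigma_t^2)$ for all $l>0$. **Algorithm (Weighted OFUL, regularisation $\lambda=1$, norm bound $B=1$, confidence parameter $\delta$).** Put $\bar\sigma_t=\max\{1/\sqrt d,\sigma_t\}$, $\bar\sigma_{\min,t}=\min_{1\le s\le t}\bar\sigma_s$, $A_t=\lambda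 I+\sum_{s\le t}\bar\sigma_s^{-2}x_sx_s^{\mathsf T}$, $c_t=\sum_{s\le t}\bar\sigma_s^{-2}r_sx_s$, $\hat\theta_t=A_t^{-1}c_t$, $\hat\beta_0=0$, $$\hat\beta_t=8\sqrt{d\,\ln\Big(1+\frac{t}{d\lambda\bar\sigma_{\min,t}^2}\Big)\ln\frac{4t^2}{\delta}}\quad(t\ge1),\qquad \Theta_t=\{\theta:\sqrt{(\theta-\hat\theta_t)^{\mathsf T}A_t(\theta-\hat\theta_t)}\le\hat\beta_t+\sqrt\lambda B\}.$$ In round $t$ it plays some $x_t\in\arg\max_{x\in\mathbb B^d}\max_{\theta\in\Theta_{t-1}}\langle x,\theta\rangle$, with ties broken arbitrarily (subject to $x_t$ being $\mathcal F_{t-1}$-measurable). **Claim.** There is an integer $p\ge 0$ such that for every $\delta_0\in(0,1)$ there is a constant $K>0$, depending only on $\delta_0$, such that the following holds for all $d,T\ge1$, all $\delta\in(0,\delta_0]$, and every instance as above. With probability at least $1-\delta$, the regret $\mathcal R_T=\max_{x\in\mathbb B^d}\sum_{t=1}^T\langle x,\theta^\ast\rangle-\sum_{t=1}^T\langle x_t,\theta^\ast\rangle$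 of Weighted OFUL satisfies $$\mathcal R_T\le C\left(\sqrt{dT\log\tfrac1\delta}+d\sqrt{\sum_{t=1}^T\sigma_t^2\log\tfrac1\delta}\right),\qquad C=K\big(1+\log T+\log d+\log(1+\log\tfrac1\delta)\big)^p ,$$ that is, $C=\tilde{\mathcal O}(1)$. -/

import Mathlib

open MeasureTheory ProbabilityTheory

noncomputable section

namespace WeightedOFUL

/-! ### Noise -/

/-- `X` is conditionally symmetric about `0` given `m`: conditionally on `m`, the real random
variables `X` and `-X` have the same law. No density is required, so that degenerate (zero) noise
is allowed. -/
def CondSymmetric {Ω : Type*} (m : MeasurableSpace Ω) {mΩ : MeasurableSpace Ω} (μ : Measure[mΩ] Ω)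
    (X : Ω → ℝ) : Prop :=
  ∀ B : Set ℝ, MeasurableSet B →
    μ⟦{ω | X ω ∈ B} | m⟧ =ᵐ[μ] μ⟦{ω | -X ω ∈ B} | m⟧

/-- `X` is conditionally sub-Gaussian given `m` with (random, `m`-measurable) variance proxy `σ ^ 2`:
`E[exp (l (X - E[X | m])) | m] ≤ exp (l ^ 2 σ ^ 2 / 2)` a.s. for all `l > 0`. The outer conditional
expectation is that of a `[0, ∞]`-valued function, so no junk value arises for a
non-integrable exponential. -/
def CondSubGaussian {Ω : Type*} (m : MeasurableSpace Ω) {mΩ : MeasurableSpace Ω} (μ : Measure[mΩ] Ω)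
    (X σ : Ω → ℝ) : Prop :=
  ∀ l : ℝ, 0 < l →
    μ⁻[fun ω => ENNReal.ofReal (Real.exp (l * (X ω - (μ[X | m]) ω))) | m]
      ≤ᵐ[μ] fun ω => ENNReal.ofReal (Real.exp (l ^ 2 * σ ω ^ 2 / 2))

/-! ### The algorithm

Sequences are indexed by rounds `1, 2, 3, …` (the value at index `0` is never used); the internal
state after `t` rounds carries the index `t`. -/

/-- The unit ball of `ℝ^d`, which is the action set. -/
def actionSet (d : ℕ) : Set (EuclideanSpace ℝ (Fin d)) := {x | ‖x‖ ≤ 1}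

/-- The Mahalanobis norm `‖v‖_A = √(vᵀ A v)`. -/
def matNorm {d : ℕ} (A : Matrix (Fin d) (Fin d) ℝ) (v : EuclideanSpace ℝ (Fin d)) : ℝ :=
  Real.sqrt (v.ofLp ⬝ᵥ (A.mulVec v.ofLp))

/-- The truncated deviations `σ̄_t = max {1 / √d, σ_t}`. -/
def sigmaBar (d : ℕ) (σ : ℕ → ℝ) (t : ℕ) : ℝ := max (1 / Real.sqrt d) (σ t)

/-- `σ̄_{min, t + 1} = min_{1 ≤ s ≤ t + 1} σ̄_s`. -/
def sigmaBarMin (d : ℕ) (σ : ℕ → ℝ) (t : ℕ) : ℝ :=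
  (Finset.Icc 1 (t + 1)).inf' ⟨1, by simp⟩ (sigmaBar d σ)

/-- The confidence radius `β̂_t`: `β̂_0 = 0` and, for `t ≥ 1`,
`β̂_t = 8 √(d ln (1 + t / (d lam σ̄_{min, t} ^ 2)) ln (4 t ^ 2 / δ))`. -/
def radius (d : ℕ) (lam δ : ℝ) (σ : ℕ → ℝ) : ℕ → ℝ
  | 0 => 0
  | t + 1 => 8 * Real.sqrt
      (d * Real.log (1 + (t + 1 : ℝ) / (d * lam * sigmaBarMin d σ t ^ 2))
        * Real.log (4 * (t + 1 : ℝ) ^ 2 / δ))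

/-- `A_0 = lam I`, `A_t = A_{t-1} + x_t x_tᵀ / σ̄_t ^ 2`. -/
def gram {d : ℕ} (lam : ℝ) (σ : ℕ → ℝ) (x : ℕ → EuclideanSpace ℝ (Fin d)) :
    ℕ → Matrix (Fin d) (Fin d) ℝ
  | 0 => lam • (1 : Matrix (Fin d) (Fin d) ℝ)
  | t + 1 => gram lam σ x t +
      (1 / sigmaBar d σ (t + 1) ^ 2) • Matrix.vecMulVec (x (t + 1)).ofLp (x (t + 1)).ofLp

/-- `c_0 = 0`, `c_t = c_{t-1} + r_t x_t / σ̄_t ^ 2`. -/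
def response {d : ℕ} (σ r : ℕ → ℝ) (x : ℕ → EuclideanSpace ℝ (Fin d)) :
    ℕ → EuclideanSpace ℝ (Fin d)
  | 0 => 0
  | t + 1 => response σ r x t + (r (t + 1) / sigmaBar d σ (t + 1) ^ 2) • x (t + 1)

/-- The weighted ridge estimator `θ̂_t = A_t⁻¹ c_t`. -/
def estimator {d : ℕ} (lam : ℝ) (σ r : ℕ → ℝ) (x : ℕ → EuclideanSpace ℝ (Fin d)) (t : ℕ) :
    EuclideanSpace ℝ (Fin d) :=
  WithLp.toLp 2 ((gram lam σ x t)⁻¹.mulVec (response σ r x t).ofLp)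

/-- The confidence ellipsoid `Θ_t = {θ | ‖θ - θ̂_t‖_{A_t} ≤ β̂_t + √lam B}`. -/
def confidenceSet {d : ℕ} (lam B δ : ℝ) (σ r : ℕ → ℝ) (x : ℕ → EuclideanSpace ℝ (Fin d)) (t : ℕ) :
    Set (EuclideanSpace ℝ (Fin d)) :=
  {θ | matNorm (gram lam σ x t) (θ - estimator lam σ r x t)
        ≤ radius d lam δ σ t + Real.sqrt lam * B}

/-- `max_{θ ∈ Θ_t} ⟨y, θ⟩`, the optimistic value of the action `y` after `t` rounds. For `lam > 0`
and `B ≥ 0` the set `Θ_t` is compact and nonempty, so that this supremum is a maximum. -/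
def optimisticValue {d : ℕ} (lam B δ : ℝ) (σ r : ℕ → ℝ) (x : ℕ → EuclideanSpace ℝ (Fin d)) (t : ℕ)
    (y : EuclideanSpace ℝ (Fin d)) : ℝ :=
  sSup ((fun θ => inner ℝ y θ) '' confidenceSet lam B δ σ r x t)

/-- The actions `x_1, …, x_T` are those of Weighted OFUL with regularisation `lam`, norm bound `B`
and confidence parameter `δ`, when the feedback is `r_1, …, r_T` and the revealed deviations are
`σ_1, …, σ_T`: in each round `t`, `x_t ∈ argmax_{y} max_{θ ∈ Θ_{t-1}} ⟨y, θ⟩` over the unit ball.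
Ties may be broken in any way. -/
def IsRun {d : ℕ} (lam B δ : ℝ) (T : ℕ) (σ r : ℕ → ℝ) (x : ℕ → EuclideanSpace ℝ (Fin d)) : Prop :=
  ∀ t < T, x (t + 1) ∈ actionSet d ∧
    IsMaxOn (optimisticValue lam B δ σ r x t) (actionSet d) (x (t + 1))

/-- The regret `max_{‖y‖ ≤ 1} ∑_{t=1}^T ⟨y, θ⋆⟩ - ∑_{t=1}^T ⟨x_t, θ⋆⟩`. -/
def regret {d : ℕ} (θstar : EuclideanSpace ℝ (Fin d)) (T : ℕ)
    (x : ℕ → EuclideanSpace ℝ (Fin d)) : ℝ :=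
  sSup ((fun y => ∑ _t ∈ Finset.Icc 1 T, inner ℝ y θstar) '' actionSet d)
    - ∑ t ∈ Finset.Icc 1 T, inner ℝ (x t) θstar

end WeightedOFUL

end

namespace WeightedOFUL

open scoped ENNReal

/-! ### One step of conditionally sub-Gaussian noise -/

section Noise

variable {Ω : Type*} {m mΩ : MeasurableSpace Ω} {μ : Measure Ω}

/-! Suppose every ellipsoid contains `θ⋆`. Optimism then bounds the regret of round `t` by `2 (β +
1) σ̄_t √q_t`, where `β` dominates all radii and `q_t` is the squared `A_{t-1}⁻¹`-norm of `x_t /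
σ̄_t` (`inner_le_of_isMaxOn`); it is also at most `2`. Cauchy–Schwarz separates `∑ σ̄_t² ≤ T / d + ∑
σ_t²` from `∑ min(1, q_t) ≤ 2 d log (1 + T)`, the elliptical potential bound `sum_min_invForm_le`.
Up to logarithms `β` is of order `√(d log (1/δ))`, and the product has the two claimed terms
(`regret_le`, `final_bound_le`). The remaining `4 d log (1 + T)` is absorbed if `d ≤ T`; if `T ≤ d`,
the trivial bound `2 T` suffices. Inserting `log (1/δ)` where it is missing costs the factor `1 + 1
/ log (1/δ₀)`.

The substance is that the radius is valid (`sqrt_invForm_noiseSum_le`). The integral of a quadratic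
exponential of the new noise is at most its Gaussian value (`lintegral_exp_quadratic_le`). Hence,
with `S_t` the weighted noise sum, the integral of `exp (‖S_t‖²_{A_t⁻¹} / 2) / √det A_t` stays at
most `1`, and Markov's inequality gives `‖S_t‖²_{A_t⁻¹} < 2 l + log det A_t ≤ 2 l + d L`, where `l =
log (4 t² / δ)`, `L = log (1 + y)` and `y = t / (d σ̄_min²)`. The squared radius is the product `64
d L l`, which need not dominate `2 l` when `y` is small.

In that regime a second potential, `exp (σ̄_min² ‖S_t‖² / (2 (t + n))) / √(t + n)` with `n = t`,
bounds the Euclidean norm: `‖S_t‖² ≤ 5 d y l`, and `y ≤ 2 L` for `y ≤ 1`. A union bound over the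
rounds and both potentials costs `δ` in total (`exists_confidence_event`). -/

/-- The measures with densities `f` and `g`, restricted to the σ-algebra `m`, are ordered; `h` is
integrated against both. -/
lemma lintegral_mul_le_of_setLIntegral_le (hm : m ≤ mΩ) {f g h : Ω → ℝ≥0∞}
    (hf : Measurable f) (hg : Measurable g) (hh : Measurable[m] h)
    (hfg : ∀ A, MeasurableSet[m] A → ∫⁻ ω in A, f ω ∂μ ≤ ∫⁻ ω in A, g ω ∂μ) :
    ∫⁻ ω, h ω * f ω ∂μ ≤ ∫⁻ ω, h ω * g ω ∂μ := by
  have e : ∀ f : Ω → ℝ≥0∞, Measurable f →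
      ∫⁻ ω, h ω * f ω ∂μ = ∫⁻ ω, h ω ∂((μ.withDensity f).trim hm) := by
    intro f hf
    rw [lintegral_trim hm hh, lintegral_withDensity_eq_lintegral_mul _ hf (hh.mono hm le_rfl)]
    simp [mul_comm]
  rw [e f hf, e g hg]
  refine lintegral_mono' (Measure.le_iff.2 fun A hA => ?_) le_rfl
  rw [trim_measurableSet_eq hm hA, trim_measurableSet_eq hm hA,
    withDensity_apply _ (hm A hA), withDensity_apply _ (hm A hA)]
  exact hfg A hA

variable [IsProbabilityMeasure μ] {X σ : Ω → ℝ}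

lemma CondSymmetric.map_restrict_eq (hm : m ≤ mΩ) (hX : Measurable X)
    (h : CondSymmetric m μ X) {A : Set Ω} (hA : MeasurableSet[m] A) :
    (μ.restrict A).map X = (μ.restrict A).map (fun ω => -X ω) := by
  ext B hB
  have h1 : MeasurableSet {ω | X ω ∈ B} := hX hB
  have h2 : MeasurableSet {ω | -X ω ∈ B} := hX.neg hB
  rw [Measure.map_apply hX hB, Measure.map_apply (show Measurable fun ω => -X ω from hX.neg) hB]
  have key : ∀ s : Set Ω, MeasurableSet s →
      ∫ ω in A, (μ⟦s | m⟧) ω ∂μ = (μ.restrict A).real s := by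
    intro s hs
    rw [setIntegral_condExp hm ((integrable_const (1 : ℝ)).indicator hs) hA,
      integral_indicator hs]
    simp
  have h3 : (μ.restrict A).real {ω | X ω ∈ B} = (μ.restrict A).real {ω | -X ω ∈ B} := by
    rw [← key _ h1, ← key _ h2]
    exact integral_congr_ae (ae_restrict_of_ae (h B hB))
  exact (ENNReal.toReal_eq_toReal_iff' (measure_ne_top _ _) (measure_ne_top _ _)).1 h3

lemma CondSymmetric.condExp_eq_zero (hm : m ≤ mΩ) (hX : Measurable X)
    (h : CondSymmetric m μ X) : μ[X | m] =ᵐ[μ] 0 := by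
  by_cases hi : Integrable X μ
  · symm
    refine ae_eq_condExp_of_forall_setIntegral_eq hm hi (fun _ _ _ => integrableOn_zero) ?_
      stronglyMeasurable_zero.aestronglyMeasurable
    intro A hA _
    have e := congrArg (fun ν : Measure ℝ => ∫ y, y ∂ν) (h.map_restrict_eq hm hX hA)
    rw [integral_map hX.aemeasurable (by fun_prop), integral_map
      (show Measurable fun ω => -X ω from hX.neg).aemeasurable (by fun_prop), integral_neg] at e
    simp only [Pi.zero_apply, integral_zero]
    linarith
  -- The conditional expectation of a non-integrable function is `0` by convention.
  · rw [condExp_of_not_integrable hi]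

/-- Symmetry does two things: it removes the centring, and it carries the one-sided hypothesis over
to negative exponents. -/
lemma CondSubGaussian.setLIntegral_exp_le (hm : m ≤ mΩ) (hX : Measurable X)
    (h : CondSymmetric m μ X) (hs : CondSubGaussian m μ X σ) (k : ℝ)
    {A : Set Ω} (hA : MeasurableSet[m] A) :
    ∫⁻ ω in A, ENNReal.ofReal (Real.exp (k * X ω)) ∂μ
      ≤ ∫⁻ ω in A, ENNReal.ofReal (Real.exp (k ^ 2 * σ ω ^ 2 / 2)) ∂μ := by
  have pos : ∀ l : ℝ, 0 < l → ∫⁻ ω in A, ENNReal.ofReal (Real.exp (l * X ω)) ∂μ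
      ≤ ∫⁻ ω in A, ENNReal.ofReal (Real.exp (l ^ 2 * σ ω ^ 2 / 2)) ∂μ := by
    intro l hl
    have e : ∫⁻ ω in A, ENNReal.ofReal (Real.exp (l * X ω)) ∂μ
        = ∫⁻ ω in A, ENNReal.ofReal (Real.exp (l * (X ω - (μ[X | m]) ω))) ∂μ := by
      refine lintegral_congr_ae (ae_restrict_of_ae ?_)
      filter_upwards [h.condExp_eq_zero hm hX] with ω hω
      simp [hω]
    rw [e, ← setLIntegral_condLExp hm μ _ hA]
    exact lintegral_mono_ae (ae_restrict_of_ae (hs l hl))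
  rcases lt_trichotomy k 0 with hk | hk | hk
  · have e := congrArg (fun ν : Measure ℝ => ∫⁻ y, ENNReal.ofReal (Real.exp (k * y)) ∂ν)
      (h.map_restrict_eq hm hX hA)
    rw [lintegral_map (by fun_prop) hX,
      lintegral_map (by fun_prop) (show Measurable fun ω => -X ω from hX.neg)] at e
    rw [e]
    simpa using pos (-k) (by linarith)
  · simp [hk]
  · exact pos k hk

/-- Rounding towards zero to a multiple of `1 / (n + 1)`. -/
noncomputable def roundToZero (n : ℕ) (l : ℝ) : ℤ :=
  if 0 ≤ l then ⌊(n + 1) * l⌋ else ⌈(n + 1) * l⌉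

lemma measurable_roundToZero (n : ℕ) : Measurable (roundToZero n) := by
  unfold roundToZero
  refine Measurable.ite measurableSet_Ici ?_ ?_
  · exact Int.measurable_floor.comp (by fun_prop)
  · exact Int.measurable_ceil.comp (by fun_prop)

lemma abs_roundToZero_div_le (n : ℕ) (l : ℝ) : |(roundToZero n l : ℝ) / (n + 1)| ≤ |l| := by
  have hn : (0 : ℝ) < n + 1 := by positivity
  rw [abs_div, abs_of_pos hn, div_le_iff₀ hn]
  unfold roundToZero
  split_ifs with h
  · have : (0 : ℤ) ≤ ⌊(n + 1) * l⌋ := Int.floor_nonneg.2 (by positivity)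
    rw [abs_of_nonneg (by exact_mod_cast this), abs_of_nonneg h]
    linarith [Int.floor_le ((n + 1) * l)]
  · push Not at h
    have : ⌈(n + 1) * l⌉ ≤ (0 : ℤ) := Int.ceil_le.2 (by simp; nlinarith)
    rw [abs_of_nonpos (by exact_mod_cast this), abs_of_neg h]
    linarith [Int.le_ceil ((n + 1) * l)]

lemma abs_roundToZero_div_sub_le (n : ℕ) (l : ℝ) :
    |(roundToZero n l : ℝ) / (n + 1) - l| ≤ 1 / ((n : ℝ) + 1) := by
  have hn : (0 : ℝ) < n + 1 := by positivity
  have e : (roundToZero n l : ℝ) / (n + 1) - l = (roundToZero n l - (n + 1) * l) / (n + 1) := by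
    field_simp
  rw [e, abs_div, abs_of_pos hn]
  gcongr
  unfold roundToZero
  rw [abs_le]
  split_ifs
  · constructor <;> linarith [Int.floor_le ((n + 1) * l), Int.lt_floor_add_one ((n + 1) * l)]
  · constructor <;> linarith [Int.le_ceil ((n + 1) * l), Int.ceil_lt_add_one ((n + 1) * l)]

lemma tendsto_roundToZero_div (l : ℝ) :
    Filter.Tendsto (fun n : ℕ => (roundToZero n l : ℝ) / (n + 1)) Filter.atTop (nhds l) := by
  rw [tendsto_iff_norm_sub_tendsto_zero]
  exact squeeze_zero (fun _ => norm_nonneg _) (fun n => abs_roundToZero_div_sub_le n l)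
    tendsto_one_div_add_atTop_nhds_zero_nat

/-- The sub-Gaussian bound with a random exponent that is measurable for the conditioning
σ-algebra. -/
lemma CondSubGaussian.lintegral_mul_exp_le (hm : m ≤ mΩ) (hX : Measurable X)
    (hσ : Measurable[m] σ) (h : CondSymmetric m μ X) (hs : CondSubGaussian m μ X σ)
    {w : Ω → ℝ≥0∞} (hw : Measurable[m] w) {l : Ω → ℝ} (hl : Measurable[m] l) :
    ∫⁻ ω, w ω * ENNReal.ofReal (Real.exp (l ω * X ω)) ∂μ
      ≤ ∫⁻ ω, w ω * ENNReal.ofReal (Real.exp (l ω ^ 2 * σ ω ^ 2 / 2)) ∂μ := by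
  have hσ' : Measurable σ := hσ.mono hm le_rfl
  have hl' : Measurable l := hl.mono hm le_rfl
  have hw' : Measurable w := hw.mono hm le_rfl
  have hN : ∀ n, Measurable[m] fun ω => roundToZero n (l ω) := fun n =>
    (measurable_roundToZero n).comp hl
  have hN' : ∀ n, Measurable fun ω => roundToZero n (l ω) := fun n => (hN n).mono hm le_rfl
  have hNr : ∀ n, Measurable fun ω => (roundToZero n (l ω) : ℝ) / (n + 1) := fun n =>
    (measurable_from_top.comp (hN' n)).div_const _
  -- The hypothesis is available for each fixed exponent only, so the exponent is made countably
  -- valued and the integral is split over its level sets. Rounding towards zero keeps the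
  -- right-hand side below its limit.
  have step : ∀ n : ℕ, ∫⁻ ω, w ω * ENNReal.ofReal
        (Real.exp ((roundToZero n (l ω) : ℝ) / (n + 1) * X ω)) ∂μ
      ≤ ∫⁻ ω, w ω * ENNReal.ofReal (Real.exp (l ω ^ 2 * σ ω ^ 2 / 2)) ∂μ := by
    intro n
    refine le_trans ?_ (lintegral_mono (f := fun ω => w ω * ENNReal.ofReal
      (Real.exp (((roundToZero n (l ω) : ℝ) / (n + 1)) ^ 2 * σ ω ^ 2 / 2))) fun ω => ?_)
    · refine lintegral_mul_le_of_setLIntegral_le hm ?_ ?_ hw ?_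
      · have := hNr n; fun_prop
      · have := hNr n; fun_prop
      · intro A hA
        have hU : A = ⋃ k : ℤ, A ∩ {ω | roundToZero n (l ω) = k} := by
          ext ω; simp
        have hmk : ∀ k : ℤ, MeasurableSet[m] (A ∩ {ω | roundToZero n (l ω) = k}) := fun k =>
          hA.inter (hN n (measurableSet_singleton k))
        have hd : Pairwise (Function.onFun Disjoint
            fun k : ℤ => A ∩ {ω | roundToZero n (l ω) = k}) := by
          intro i j hij
          rw [Function.onFun, Set.disjoint_left]
          rintro ω ⟨_, h1⟩ ⟨_, h2⟩
          exact hij (h1.symm.trans h2)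
        rw [hU, lintegral_iUnion (fun k => hm _ (hmk k)) hd,
          lintegral_iUnion (fun k => hm _ (hmk k)) hd]
        refine ENNReal.tsum_le_tsum fun k => ?_
        have := hs.setLIntegral_exp_le hm hX h ((k : ℝ) / (n + 1)) (hmk k)
        refine le_trans (le_of_eq ?_) (this.trans (le_of_eq ?_))
        · refine setLIntegral_congr_fun (hm _ (hmk k)) fun ω hω => ?_
          rw [show roundToZero n (l ω) = k from hω.2]
        · refine setLIntegral_congr_fun (hm _ (hmk k)) fun ω hω => ?_
          rw [show roundToZero n (l ω) = k from hω.2]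
    · dsimp only
      gcongr w ω * ENNReal.ofReal (Real.exp (?_ * _ / 2))
      exact sq_le_sq.2 (abs_roundToZero_div_le n (l ω))
  have lim : ∀ ω, Filter.Tendsto (fun n : ℕ => ENNReal.ofReal
      (Real.exp ((roundToZero n (l ω) : ℝ) / (n + 1) * X ω))) Filter.atTop
      (nhds (ENNReal.ofReal (Real.exp (l ω * X ω)))) := fun ω =>
    ENNReal.tendsto_ofReal ((Real.continuous_exp.tendsto _).comp
      ((tendsto_roundToZero_div (l ω)).mul_const _))
  -- Fatou's lemma removes the rounding without any domination.
  calc ∫⁻ ω, w ω * ENNReal.ofReal (Real.exp (l ω * X ω)) ∂μ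
      ≤ ∫⁻ ω, Filter.liminf (fun n : ℕ => w ω * ENNReal.ofReal
        (Real.exp ((roundToZero n (l ω) : ℝ) / (n + 1) * X ω))) Filter.atTop ∂μ := by
        refine lintegral_mono fun ω => le_of_eq ?_
        refine (Filter.Tendsto.liminf_eq ?_).symm
        refine ENNReal.Tendsto.const_mul (lim ω) (Or.inl ?_)
        simp [Real.exp_pos]
    _ ≤ Filter.liminf (fun n : ℕ => ∫⁻ ω, w ω * ENNReal.ofReal
        (Real.exp ((roundToZero n (l ω) : ℝ) / (n + 1) * X ω)) ∂μ) Filter.atTop := by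
        refine lintegral_liminf_le fun n => ?_
        have := hNr n; fun_prop
    _ ≤ _ := by
        refine Filter.liminf_le_of_frequently_le' (Filter.Frequently.of_forall step)

end Noise

/-! ### Gaussian integrals -/

section Gaussian

lemma lintegral_exp_mul_gaussianReal (t : ℝ) :
    ∫⁻ g, ENNReal.ofReal (Real.exp (t * g)) ∂(gaussianReal 0 1)
      = ENNReal.ofReal (Real.exp (t ^ 2 / 2)) := by
  rw [← ofReal_integral_eq_lintegral_ofReal (integrable_exp_mul_gaussianReal t)
    (Filter.Eventually.of_forall fun _ => (Real.exp_pos _).le)]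
  have := congrFun (mgf_id_gaussianReal (μ := 0) (v := 1)) t
  simp only [mgf, id] at this
  rw [this]
  simp

/-- Completing the square turns the integrand times the standard density into a constant times the
density of mean `a √b / (1 - b)` and variance `1 / (1 - b)`. -/
lemma lintegral_exp_sq_gaussianReal {a b : ℝ} (hb : 0 ≤ b) (hb1 : b < 1) :
    ∫⁻ g, ENNReal.ofReal (Real.exp ((a + Real.sqrt b * g) ^ 2 / 2)) ∂(gaussianReal 0 1)
      = ENNReal.ofReal (Real.exp (a ^ 2 / (2 * (1 - b))) / Real.sqrt (1 - b)) := by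
  have h1 : 0 < 1 - b := by linarith
  obtain ⟨v, hv⟩ : ∃ v : NNReal, (v : ℝ) = (1 - b)⁻¹ := ⟨⟨(1 - b)⁻¹, by positivity⟩, rfl⟩
  have hv0 : v ≠ 0 := by
    rintro rfl
    exact (inv_ne_zero h1.ne') (by simpa using hv.symm)
  set C : ℝ := Real.exp (a ^ 2 / (2 * (1 - b))) / Real.sqrt (1 - b) with hC
  have hC0 : 0 ≤ C := by positivity
  rw [gaussianReal_of_var_ne_zero 0 one_ne_zero,
    lintegral_withDensity_eq_lintegral_mul _ (measurable_gaussianPDF 0 1) (by fun_prop)]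
  have key : ∀ x, (gaussianPDF 0 1 * fun g => ENNReal.ofReal
      (Real.exp ((a + Real.sqrt b * g) ^ 2 / 2))) x
      = ENNReal.ofReal C * gaussianPDF (a * Real.sqrt b / (1 - b)) v x := by
    intro x
    simp only [Pi.mul_apply, gaussianPDF]
    rw [← ENNReal.ofReal_mul (gaussianPDFReal_nonneg _ _ _), ← ENNReal.ofReal_mul hC0]
    congr 1
    simp only [gaussianPDFReal, hC, hv, NNReal.coe_one]
    have e1 : Real.sqrt (2 * Real.pi * (1 - b)⁻¹) = Real.sqrt (2 * Real.pi) / Real.sqrt (1 - b) := by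
      rw [← div_eq_mul_inv, Real.sqrt_div (by positivity)]
    have hs : Real.sqrt (1 - b) ≠ 0 := (Real.sqrt_pos.2 h1).ne'
    have hp : Real.sqrt (2 * Real.pi) ≠ 0 := (Real.sqrt_pos.2 (by positivity)).ne'
    rw [mul_one, e1, inv_div, mul_assoc, ← Real.exp_add]
    have e2 : Real.exp (a ^ 2 / (2 * (1 - b))) / Real.sqrt (1 - b) *
        (Real.sqrt (1 - b) / Real.sqrt (2 * Real.pi) *
          Real.exp (-(x - a * Real.sqrt b / (1 - b)) ^ 2 / (2 * (1 - b)⁻¹)))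
        = (Real.sqrt (2 * Real.pi))⁻¹ * Real.exp (a ^ 2 / (2 * (1 - b)) +
          -(x - a * Real.sqrt b / (1 - b)) ^ 2 / (2 * (1 - b)⁻¹)) := by
      rw [Real.exp_add]; field_simp
    rw [e2]
    congr 2
    have hbb : Real.sqrt b ^ 2 = b := Real.sq_sqrt hb
    field_simp
    ring_nf
    rw [hbb]
    ring
  simp_rw [key]
  rw [lintegral_const_mul _ (measurable_gaussianPDF _ _), lintegral_gaussianPDF_eq_one _ hv0,
    mul_one]

end Gaussian

/-! ### Quadratic exponentials of the noise -/

section Noise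

variable {Ω : Type*} {m mΩ : MeasurableSpace Ω} {μ : Measure Ω} [IsProbabilityMeasure μ]
  {X σ : Ω → ℝ}

/-- One step of noise in an exponential of a quadratic polynomial whose coefficients are measurable
for the conditioning σ-algebra. -/
lemma CondSubGaussian.lintegral_exp_quadratic_le (hm : m ≤ mΩ) (hX : Measurable X)
    (hσ : Measurable[m] σ) (hσ0 : ∀ ω, 0 ≤ σ ω)
    (h : CondSymmetric m μ X) (hs : CondSubGaussian m μ X σ)
    {s a b c : Ω → ℝ} (hsm : Measurable[m] s) (ha : Measurable[m] a) (hb : Measurable[m] b)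
    (hc : Measurable[m] c) (hs0 : ∀ ω, 0 < s ω) (hσs : ∀ ω, σ ω ≤ s ω)
    (hb0 : ∀ ω, 0 ≤ b ω) (hb1 : ∀ ω, b ω < 1) :
    ∫⁻ ω, ENNReal.ofReal (Real.exp (c ω + a ω * (X ω / s ω) + b ω * (X ω / s ω) ^ 2 / 2)) ∂μ
      ≤ ∫⁻ ω, ENNReal.ofReal
        (Real.exp (c ω + a ω ^ 2 / (2 * (1 - b ω))) / Real.sqrt (1 - b ω)) ∂μ := by
  have ha' : Measurable a := ha.mono hm le_rfl
  have hb' : Measurable b := hb.mono hm le_rfl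
  have hc' : Measurable c := hc.mono hm le_rfl
  have hs' : Measurable s := hsm.mono hm le_rfl
  have hσ' : Measurable σ := hσ.mono hm le_rfl
  -- Gaussian linearisation: `exp (b z² / 2)` is the mean of `exp (√b z g)` over a standard normal
  -- `g`. For fixed `g` the exponent is linear in the noise, so the sub-Gaussian bound applies
  -- between two uses of Tonelli.
  calc ∫⁻ ω, ENNReal.ofReal (Real.exp (c ω + a ω * (X ω / s ω) + b ω * (X ω / s ω) ^ 2 / 2)) ∂μ
      = ∫⁻ ω, ∫⁻ g, ENNReal.ofReal (Real.exp (c ω)) * ENNReal.ofReal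
          (Real.exp ((a ω + Real.sqrt (b ω) * g) / s ω * X ω)) ∂(gaussianReal 0 1) ∂μ := by
        refine lintegral_congr fun ω => ?_
        have e : ∀ g, ENNReal.ofReal (Real.exp (c ω)) * ENNReal.ofReal
            (Real.exp ((a ω + Real.sqrt (b ω) * g) / s ω * X ω))
            = ENNReal.ofReal (Real.exp (c ω + a ω * (X ω / s ω))) * ENNReal.ofReal
              (Real.exp ((Real.sqrt (b ω) * (X ω / s ω)) * g)) := by
          intro g
          rw [← ENNReal.ofReal_mul (Real.exp_pos _).le, ← ENNReal.ofReal_mul (Real.exp_pos _).le,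
            ← Real.exp_add, ← Real.exp_add]
          congr 2
          ring
        simp_rw [e]
        rw [lintegral_const_mul _ (by fun_prop), lintegral_exp_mul_gaussianReal,
          ← ENNReal.ofReal_mul (Real.exp_pos _).le, ← Real.exp_add, mul_pow,
          Real.sq_sqrt (hb0 ω)]
    _ = ∫⁻ g, ∫⁻ ω, ENNReal.ofReal (Real.exp (c ω)) * ENNReal.ofReal
          (Real.exp ((a ω + Real.sqrt (b ω) * g) / s ω * X ω)) ∂μ ∂(gaussianReal 0 1) := by
        refine lintegral_lintegral_swap (Measurable.aemeasurable ?_)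
        unfold Function.uncurry
        fun_prop
    _ ≤ ∫⁻ g, ∫⁻ ω, ENNReal.ofReal (Real.exp (c ω)) * ENNReal.ofReal
          (Real.exp ((a ω + Real.sqrt (b ω) * g) ^ 2 / 2)) ∂μ ∂(gaussianReal 0 1) := by
        refine lintegral_mono fun g => ?_
        refine (hs.lintegral_mul_exp_le hm hX hσ h (w := fun ω => ENNReal.ofReal (Real.exp (c ω)))
          (l := fun ω => (a ω + Real.sqrt (b ω) * g) / s ω)
          (Measurable.ennreal_ofReal (Real.measurable_exp.comp hc))
          ((ha.add ((Real.continuous_sqrt.measurable.comp hb).mul_const g)).div hsm)).trans ?_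
        refine lintegral_mono fun ω => ?_
        dsimp only
        gcongr
        have h1 : σ ω ^ 2 ≤ s ω ^ 2 := pow_le_pow_left₀ (hσ0 ω) (hσs ω) 2
        rw [div_pow, div_mul_eq_mul_div, div_le_iff₀ (pow_pos (hs0 ω) 2)]
        exact mul_le_mul_of_nonneg_left h1 (sq_nonneg _)
    _ = ∫⁻ ω, ∫⁻ g, ENNReal.ofReal (Real.exp (c ω)) * ENNReal.ofReal
          (Real.exp ((a ω + Real.sqrt (b ω) * g) ^ 2 / 2)) ∂(gaussianReal 0 1) ∂μ := by
        refine (lintegral_lintegral_swap (Measurable.aemeasurable ?_)).symm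
        unfold Function.uncurry
        fun_prop
    _ = _ := by
        refine lintegral_congr fun ω => ?_
        rw [lintegral_const_mul _ (by fun_prop), lintegral_exp_sq_gaussianReal (hb0 ω) (hb1 ω),
          ← ENNReal.ofReal_mul (Real.exp_pos _).le, ← mul_div_assoc, ← Real.exp_add]

end Noise

/-! ### Quadratic forms of inverse matrices -/

section InverseForm

open Matrix

variable {n : Type*} [Fintype n]

lemma dotProduct_mulVec_comm {A : Matrix n n ℝ} (hA : A.IsHermitian) (u v : n → ℝ) :
    u ⬝ᵥ (A *ᵥ v) = v ⬝ᵥ (A *ᵥ u) := by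
  have hT : Aᵀ = A := by simpa [IsHermitian] using hA
  rw [dotProduct_mulVec, ← mulVec_transpose, hT, dotProduct_comm]

/-- The quadratic form at `u + s v` is nonnegative for all `s`, so its discriminant is at most `0`.
-/
lemma sq_dotProduct_mulVec_le {B : Matrix n n ℝ} (hB : B.PosDef) (u v : n → ℝ) :
    (u ⬝ᵥ (B *ᵥ v)) ^ 2 ≤ (u ⬝ᵥ (B *ᵥ u)) * (v ⬝ᵥ (B *ᵥ v)) := by
  have h : ∀ s : ℝ, 0 ≤ (v ⬝ᵥ (B *ᵥ v)) * (s * s) + 2 * (u ⬝ᵥ (B *ᵥ v)) * s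
      + u ⬝ᵥ (B *ᵥ u) := by
    intro s
    have := hB.posSemidef.dotProduct_mulVec_nonneg (u + s • v)
    simp only [star_trivial, mulVec_add, mulVec_smul, add_dotProduct, dotProduct_add,
      smul_dotProduct, dotProduct_smul, smul_eq_mul] at this
    rw [dotProduct_mulVec_comm hB.isHermitian v u] at this
    linarith
  have := discrim_le_zero h
  rw [discrim] at this
  linarith

lemma posDef_add_vecMulVec {A : Matrix n n ℝ} (hA : A.PosDef) (w : n → ℝ) :
    (A + vecMulVec w w).PosDef :=
  hA.add_posSemidef (by simpa using posSemidef_vecMulVec_self_star w)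

variable [DecidableEq n]

/-- The bilinear form `uᵀ A⁻¹ v`. -/
noncomputable def invForm (A : Matrix n n ℝ) (u v : n → ℝ) : ℝ := u ⬝ᵥ (A⁻¹ *ᵥ v)

lemma invForm_comm {A : Matrix n n ℝ} (hA : A.PosDef) (u v : n → ℝ) :
    invForm A u v = invForm A v u :=
  dotProduct_mulVec_comm hA.inv.isHermitian u v

lemma invForm_nonneg {A : Matrix n n ℝ} (hA : A.PosDef) (u : n → ℝ) : 0 ≤ invForm A u u := by
  simpa [invForm] using hA.inv.posSemidef.dotProduct_mulVec_nonneg u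

lemma mulVec_inv_mulVec {A : Matrix n n ℝ} (hA : A.PosDef) (u : n → ℝ) :
    A *ᵥ (A⁻¹ *ᵥ u) = u := by
  rw [mulVec_mulVec, mul_nonsing_inv _ ((isUnit_iff_isUnit_det _).1 hA.isUnit), one_mulVec]

lemma inv_mulVec_mulVec {A : Matrix n n ℝ} (hA : A.PosDef) (u : n → ℝ) :
    A⁻¹ *ᵥ (A *ᵥ u) = u := by
  rw [mulVec_mulVec, nonsing_inv_mul _ ((isUnit_iff_isUnit_det _).1 hA.isUnit), one_mulVec]

lemma invForm_mulVec {A : Matrix n n ℝ} (hA : A.PosDef) (u v : n → ℝ) :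
    invForm A u (A *ᵥ v) = u ⬝ᵥ v := by
  rw [invForm, inv_mulVec_mulVec hA]

lemma sq_invForm_le {A : Matrix n n ℝ} (hA : A.PosDef) (u v : n → ℝ) :
    invForm A u v ^ 2 ≤ invForm A u u * invForm A v v :=
  sq_dotProduct_mulVec_le hA.inv u v

lemma abs_invForm_le {A : Matrix n n ℝ} (hA : A.PosDef) (u v : n → ℝ) :
    |invForm A u v| ≤ Real.sqrt (invForm A u u) * Real.sqrt (invForm A v v) := by
  rw [← Real.sqrt_mul (invForm_nonneg hA u)]
  exact Real.abs_le_sqrt (sq_invForm_le hA u v)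

lemma abs_dotProduct_le {A : Matrix n n ℝ} (hA : A.PosDef) (u v : n → ℝ) :
    |u ⬝ᵥ v| ≤ Real.sqrt (invForm A u u) * Real.sqrt (v ⬝ᵥ (A *ᵥ v)) := by
  have := abs_invForm_le hA u (A *ᵥ v)
  rwa [invForm_mulVec hA, invForm_mulVec hA, dotProduct_comm (A *ᵥ v)] at this

lemma sqrt_invForm_sub_le {A : Matrix n n ℝ} (hA : A.PosDef) (u v : n → ℝ) :
    Real.sqrt (invForm A (u - v) (u - v))
      ≤ Real.sqrt (invForm A u u) + Real.sqrt (invForm A v v) := by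
  refine Real.sqrt_le_iff.2 ⟨by positivity, ?_⟩
  have h1 := (abs_le.1 (abs_invForm_le hA u v)).1
  have h2 : invForm A (u - v) (u - v) = invForm A u u - 2 * invForm A u v + invForm A v v := by
    have := invForm_comm hA u v
    simp only [invForm, mulVec_sub, sub_dotProduct, dotProduct_sub] at this ⊢
    linarith
  rw [h2, add_sq, Real.sq_sqrt (invForm_nonneg hA u), Real.sq_sqrt (invForm_nonneg hA v)]
  linarith

/-- Inversion reverses the order `I ≤ A`. With `w = A⁻¹ u`, the hypothesis reads `w ⬝ w ≤ u ⬝ w`,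
and Cauchy–Schwarz concludes. -/
lemma invForm_le_dotProduct {A : Matrix n n ℝ} (hA : A.PosDef)
    (h1 : ∀ v : n → ℝ, v ⬝ᵥ v ≤ v ⬝ᵥ (A *ᵥ v)) (u : n → ℝ) :
    invForm A u u ≤ u ⬝ᵥ u := by
  set w := A⁻¹ *ᵥ u with hw
  have e : invForm A u u = w ⬝ᵥ (A *ᵥ w) := by
    rw [hw, mulVec_inv_mulVec hA, invForm, dotProduct_comm]
  have h2 : (u ⬝ᵥ w) ^ 2 ≤ (u ⬝ᵥ u) * (w ⬝ᵥ w) := by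
    simpa using sq_dotProduct_mulVec_le (PosDef.one (n := n) (R := ℝ)) u w
  have h3 : invForm A u u = u ⬝ᵥ w := rfl
  have h4 : 0 ≤ u ⬝ᵥ u := by simpa using dotProduct_star_self_nonneg u
  have h5 := h1 w
  rw [← e, h3] at h5
  have h6 : 0 ≤ w ⬝ᵥ w := by simpa using dotProduct_star_self_nonneg w
  rw [h3]
  by_contra! hlt
  nlinarith [mul_le_mul_of_nonneg_left h5 h4]

lemma det_add_vecMulVec {A : Matrix n n ℝ} (hA : A.PosDef) (w : n → ℝ) :
    (A + vecMulVec w w).det = A.det * (1 + invForm A w w) := by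
  rw [vecMulVec_eq Unit, det_add_replicateCol_mul_replicateRow
    ((isUnit_iff_isUnit_det _).1 hA.isUnit), det_unique (n := Unit), Matrix.mul_assoc,
    ← replicateCol_mulVec]
  simp [invForm, replicateRow_mul_replicateCol_apply]

/-- Sherman–Morrison formula, proved by exhibiting the solution `y` of `(A + w wᵀ) y = u`. -/
lemma invForm_add_vecMulVec {A : Matrix n n ℝ} (hA : A.PosDef) (w u : n → ℝ) :
    invForm (A + vecMulVec w w) u u
      = invForm A u u - invForm A w u ^ 2 / (1 + invForm A w w) := by
  have hq := invForm_nonneg hA w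
  set p := invForm A w u with hp
  set q := invForm A w w with hqd
  have hq1 : (1 + q) ≠ 0 := by positivity
  set y := A⁻¹ *ᵥ u - (p / (1 + q)) • (A⁻¹ *ᵥ w) with hy
  have hwy : w ⬝ᵥ y = p / (1 + q) := by
    have : w ⬝ᵥ y = p - p / (1 + q) * q := by
      simp [hy, dotProduct_sub, hp, hqd, invForm]
    rw [this]; field_simp; ring
  have hAy : (A + vecMulVec w w) *ᵥ y = u := by
    rw [add_mulVec, vecMulVec_mulVec, op_smul_eq_smul, hwy]
    simp [hy, mulVec_sub, mulVec_smul, mulVec_inv_mulVec hA]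
  have : invForm (A + vecMulVec w w) u u = u ⬝ᵥ y := by
    rw [invForm, ← inv_mulVec_mulVec (posDef_add_vecMulVec hA w) y, hAy]
  rw [this, hy, dotProduct_sub, dotProduct_smul, smul_eq_mul]
  change invForm A u u - p / (1 + q) * invForm A u w = _
  rw [invForm_comm hA u w, ← hp]
  ring

/-- AM–GM for the eigenvalues, from the tangent line to the logarithm at their mean. -/
lemma log_det_le [Nonempty n] {A : Matrix n n ℝ} (hA : A.PosDef) :
    Real.log A.det ≤ Fintype.card n * Real.log (A.trace / Fintype.card n) := by
  have hev := hA.eigenvalues_pos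
  have hdet : A.det = ∏ i, hA.1.eigenvalues i := by
    simpa using hA.1.det_eq_prod_eigenvalues
  have htr : A.trace = ∑ i, hA.1.eigenvalues i := by
    simpa using hA.1.trace_eq_sum_eigenvalues
  have hc : 0 < A.trace / Fintype.card n := by
    rw [htr]
    exact div_pos (Finset.sum_pos (fun i _ => hev i) Finset.univ_nonempty)
      (by exact_mod_cast Fintype.card_pos)
  set c := A.trace / Fintype.card n with hcd
  rw [hdet, Real.log_prod (fun i _ => (hev i).ne')]
  have h : ∀ i, Real.log (hA.1.eigenvalues i) ≤ hA.1.eigenvalues i / c - 1 + Real.log c := by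
    intro i
    have := Real.log_le_sub_one_of_pos (div_pos (hev i) hc)
    rw [Real.log_div (hev i).ne' hc.ne'] at this
    linarith
  refine (Finset.sum_le_sum fun i _ => h i).trans (le_of_eq ?_)
  rw [Finset.sum_add_distrib, Finset.sum_sub_distrib, ← Finset.sum_div, ← htr]
  have hcard : (Fintype.card n : ℝ) ≠ 0 := by simp
  have : A.trace / c = Fintype.card n := by
    rw [div_eq_iff hc.ne', hcd]; field_simp
  simp [this]

end InverseForm

/-! ### The Gram matrix and the ridge estimator -/

section Gram

open Matrix

variable {d : ℕ}

lemma inner_eq_dotProduct (x y : EuclideanSpace ℝ (Fin d)) :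
    inner ℝ x y = x.ofLp ⬝ᵥ y.ofLp := by
  rw [EuclideanSpace.inner_eq_star_dotProduct, dotProduct_comm]; simp

lemma dotProduct_self_eq_norm_sq (x : EuclideanSpace ℝ (Fin d)) :
    x.ofLp ⬝ᵥ x.ofLp = ‖x‖ ^ 2 := by
  rw [← inner_eq_dotProduct, real_inner_self_eq_norm_sq]

lemma sigmaBar_pos (hd : 1 ≤ d) (σ : ℕ → ℝ) (t : ℕ) : 0 < sigmaBar d σ t := by
  have : (0 : ℝ) < d := by exact_mod_cast hd
  exact lt_max_of_lt_left (by positivity)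

lemma one_le_mul_sigmaBar_sq (hd : 1 ≤ d) (σ : ℕ → ℝ) (t : ℕ) :
    1 ≤ d * sigmaBar d σ t ^ 2 := by
  have h0 : (0 : ℝ) < d := by exact_mod_cast hd
  have h1 : 1 / Real.sqrt d ≤ sigmaBar d σ t := le_max_left _ _
  have h2 : (1 / Real.sqrt d) ^ 2 ≤ sigmaBar d σ t ^ 2 := by gcongr
  rw [div_pow, Real.sq_sqrt h0.le, one_pow, div_le_iff₀ h0] at h2
  linarith

lemma sigmaBarMin_le (σ : ℕ → ℝ) {s t : ℕ} (h1 : 1 ≤ s) (h : s ≤ t + 1) :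
    sigmaBarMin d σ t ≤ sigmaBar d σ s :=
  Finset.inf'_le _ (Finset.mem_Icc.2 ⟨h1, h⟩)

lemma exists_sigmaBarMin_eq (σ : ℕ → ℝ) (t : ℕ) :
    ∃ s, sigmaBarMin d σ t = sigmaBar d σ s := by
  obtain ⟨s, _, h⟩ := Finset.exists_mem_eq_inf' (s := Finset.Icc 1 (t + 1)) ⟨1, by simp⟩
    (sigmaBar d σ)
  exact ⟨s, h⟩

lemma sigmaBarMin_pos (hd : 1 ≤ d) (σ : ℕ → ℝ) (t : ℕ) : 0 < sigmaBarMin d σ t := by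
  obtain ⟨s, hs⟩ := exists_sigmaBarMin_eq (d := d) σ t
  exact hs ▸ sigmaBar_pos hd σ s

lemma one_le_mul_sigmaBarMin_sq (hd : 1 ≤ d) (σ : ℕ → ℝ) (t : ℕ) :
    1 ≤ d * sigmaBarMin d σ t ^ 2 := by
  obtain ⟨s, hs⟩ := exists_sigmaBarMin_eq (d := d) σ t
  exact hs ▸ one_le_mul_sigmaBar_sq hd σ s

lemma sigmaBarMin_succ_le (σ : ℕ → ℝ) (t : ℕ) :
    sigmaBarMin d σ (t + 1) ≤ sigmaBarMin d σ t :=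
  Finset.inf'_mono _ (Finset.Icc_subset_Icc_right (by omega)) _

/-- The action of round `t` scaled by `1 / σ̄_t`. -/
noncomputable def scaledAction (σ : ℕ → ℝ) (x : ℕ → EuclideanSpace ℝ (Fin d)) (t : ℕ) :
    Fin d → ℝ :=
  (1 / sigmaBar d σ t) • (x t).ofLp

lemma gram_succ (lam : ℝ) (σ : ℕ → ℝ) (x : ℕ → EuclideanSpace ℝ (Fin d)) (t : ℕ) :
    gram lam σ x (t + 1) = gram lam σ x t +
      vecMulVec (scaledAction σ x (t + 1)) (scaledAction σ x (t + 1)) := by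
  rw [gram, scaledAction, smul_vecMulVec, vecMulVec_smul, smul_smul]
  congr 2
  ring

lemma gram_posDef (σ : ℕ → ℝ) (x : ℕ → EuclideanSpace ℝ (Fin d)) (t : ℕ) :
    (gram 1 σ x t).PosDef := by
  induction t with
  | zero => simpa [gram] using (PosDef.one (n := Fin d) (R := ℝ))
  | succ t ih => rw [gram_succ]; exact posDef_add_vecMulVec ih _

lemma dotProduct_self_le_gram (σ : ℕ → ℝ) (x : ℕ → EuclideanSpace ℝ (Fin d)) (t : ℕ)
    (v : Fin d → ℝ) : v ⬝ᵥ v ≤ v ⬝ᵥ (gram 1 σ x t *ᵥ v) := by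
  induction t with
  | zero => simp [gram]
  | succ t ih =>
    rw [gram_succ, add_mulVec, vecMulVec_mulVec, op_smul_eq_smul, dotProduct_add,
      dotProduct_smul, smul_eq_mul, dotProduct_comm v (scaledAction σ x (t + 1))]
    nlinarith [mul_self_nonneg (scaledAction σ x (t + 1) ⬝ᵥ v)]

lemma trace_gram_le (σ : ℕ → ℝ) (x : ℕ → EuclideanSpace ℝ (Fin d)) {m : ℝ} (hm : 0 < m) (t : ℕ)
    (hx : ∀ s < t, ‖x (s + 1)‖ ≤ 1) (hσ : ∀ s < t, m ≤ sigmaBar d σ (s + 1) ^ 2) :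
    (gram 1 σ x t).trace ≤ d + t / m := by
  induction t with
  | zero => simp [gram]
  | succ t ih =>
    have h := ih (fun s hs => hx s (by omega)) (fun s hs => hσ s (by omega))
    have h1 : ‖x (t + 1)‖ ^ 2 ≤ 1 := pow_le_one₀ (norm_nonneg _) (hx t (by omega))
    have h2 : 1 / sigmaBar d σ (t + 1) ^ 2 * ‖x (t + 1)‖ ^ 2 ≤ 1 / m * 1 := by
      gcongr
      exact hσ t (by omega)
    rw [gram, trace_add, trace_smul, trace_vecMulVec, dotProduct_self_eq_norm_sq, smul_eq_mul]
    push_cast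
    rw [add_div]
    linarith

/-- The lower bound `m` is left free: it is `1 / d` in the elliptical potential bound and `σ̄_min²`
in the confidence radius. -/
lemma log_det_gram_le (hd : 1 ≤ d) (σ : ℕ → ℝ) (x : ℕ → EuclideanSpace ℝ (Fin d)) {m : ℝ}
    (hm : 0 < m) (t : ℕ)
    (hx : ∀ s < t, ‖x (s + 1)‖ ≤ 1) (hσ : ∀ s < t, m ≤ sigmaBar d σ (s + 1) ^ 2) :
    Real.log (gram 1 σ x t).det ≤ d * Real.log (1 + t / (d * m)) := by
  have hd0 : (0 : ℝ) < d := by exact_mod_cast hd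
  have : Nonempty (Fin d) := ⟨⟨0, by omega⟩⟩
  have h := log_det_le (gram_posDef σ x t)
  rw [Fintype.card_fin] at h
  refine h.trans ?_
  have htr : 0 < (gram 1 σ x t).trace := (gram_posDef σ x t).trace_pos
  gcongr
  rw [div_le_iff₀ hd0]
  refine (trace_gram_le σ x hm t hx hσ).trans (le_of_eq ?_)
  field_simp

lemma log_det_gram_succ (σ : ℕ → ℝ) (x : ℕ → EuclideanSpace ℝ (Fin d)) (t : ℕ) :
    Real.log (gram 1 σ x (t + 1)).det = Real.log (gram 1 σ x t).det +
      Real.log (1 + invForm (gram 1 σ x t) (scaledAction σ x (t + 1))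
        (scaledAction σ x (t + 1))) := by
  have h := invForm_nonneg (gram_posDef σ x t) (scaledAction σ x (t + 1))
  rw [gram_succ, det_add_vecMulVec (gram_posDef σ x t),
    Real.log_mul (gram_posDef σ x t).det_pos.ne' (by positivity)]

/-- Elliptical potential: `min(1, q) ≤ 2 log (1 + q)`, and the logarithms telescope to `log det
A_T`. -/
lemma sum_min_invForm_le (hd : 1 ≤ d) (σ : ℕ → ℝ) (x : ℕ → EuclideanSpace ℝ (Fin d)) (T : ℕ)
    (hx : ∀ s < T, ‖x (s + 1)‖ ≤ 1) :
    ∑ t ∈ Finset.range T, min 1 (invForm (gram 1 σ x t) (scaledAction σ x (t + 1))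
        (scaledAction σ x (t + 1))) ≤ 2 * (d * Real.log (1 + T)) := by
  have hd0 : (0 : ℝ) < d := by exact_mod_cast hd
  have h1 : ∀ q : ℝ, 0 ≤ q → min 1 q ≤ 2 * Real.log (1 + q) := by
    intro q hq
    have key : ∀ y : ℝ, 0 ≤ y → y ≤ 1 → y ≤ 2 * Real.log (1 + y) := by
      intro y hy hy1
      have := Real.one_sub_inv_le_log_of_pos (show 0 < 1 + y by linarith)
      have h2 : y / 2 ≤ 1 - (1 + y)⁻¹ := by
        rw [← one_div, div_le_iff₀ (by norm_num), sub_mul, le_sub_iff_add_le, div_mul_eq_mul_div,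
          ← le_sub_iff_add_le', div_le_iff₀ (by linarith)]
        nlinarith
      linarith
    rcases le_total q 1 with hq1 | hq1
    · rw [min_eq_right hq1]; exact key q hq hq1
    · rw [min_eq_left hq1]
      refine (key 1 zero_le_one le_rfl).trans ?_
      gcongr
  have h2 : ∀ n : ℕ, ∑ t ∈ Finset.range n, Real.log (1 + invForm (gram 1 σ x t)
      (scaledAction σ x (t + 1)) (scaledAction σ x (t + 1))) = Real.log (gram 1 σ x n).det := by
    intro n
    induction n with
    | zero => simp [gram]
    | succ n ih => rw [Finset.sum_range_succ, ih, log_det_gram_succ]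
  have h3 := log_det_gram_le hd σ x (m := 1 / d) (by positivity) T hx (fun s _ => by
    rw [div_le_iff₀ hd0, mul_comm]; exact one_le_mul_sigmaBar_sq hd σ (s + 1))
  rw [mul_one_div_cancel hd0.ne', div_one] at h3
  calc _ ≤ ∑ t ∈ Finset.range T, 2 * Real.log (1 + invForm (gram 1 σ x t)
        (scaledAction σ x (t + 1)) (scaledAction σ x (t + 1))) :=
        Finset.sum_le_sum fun t _ => h1 _ (invForm_nonneg (gram_posDef σ x t) _)
    _ = 2 * Real.log (gram 1 σ x T).det := by rw [← Finset.mul_sum, h2]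
    _ ≤ _ := by linarith

lemma response_eq (σ r η : ℕ → ℝ) (x : ℕ → EuclideanSpace ℝ (Fin d))
    (θ : EuclideanSpace ℝ (Fin d)) (t : ℕ)
    (hr : ∀ s < t, r (s + 1) = inner ℝ (x (s + 1)) θ + η (s + 1)) :
    (response σ r x t).ofLp
      = gram 1 σ x t *ᵥ θ.ofLp - θ.ofLp + (response σ η x t).ofLp := by
  induction t with
  | zero => simp [response, gram]
  | succ t ih =>
    have h := ih (fun s hs => hr s (by omega))
    simp only [response, gram, WithLp.ofLp_add, WithLp.ofLp_smul, h, hr t (by omega)]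
    rw [add_mulVec, smul_mulVec, vecMulVec_mulVec, op_smul_eq_smul, ← inner_eq_dotProduct]
    ext i
    simp only [Pi.add_apply, Pi.sub_apply, Pi.smul_apply, smul_eq_mul]
    ring

/-- With `S` the response to pure noise, `θ - θ̂ = A⁻¹ (θ - S)`. The regularisation error is at most
`‖θ‖` because `A ≥ I`. -/
lemma matNorm_sub_estimator_le (σ r η : ℕ → ℝ) (x : ℕ → EuclideanSpace ℝ (Fin d))
    (θ : EuclideanSpace ℝ (Fin d)) (t : ℕ)
    (hr : ∀ s < t, r (s + 1) = inner ℝ (x (s + 1)) θ + η (s + 1)) :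
    matNorm (gram 1 σ x t) (θ - estimator 1 σ r x t)
      ≤ Real.sqrt (invForm (gram 1 σ x t) (response σ η x t).ofLp (response σ η x t).ofLp)
        + ‖θ‖ := by
  have hA := gram_posDef σ x t
  have e : (θ - estimator 1 σ r x t).ofLp
      = (gram 1 σ x t)⁻¹ *ᵥ (θ.ofLp - (response σ η x t).ofLp) := by
    have h1 : θ.ofLp = (gram 1 σ x t)⁻¹ *ᵥ (gram 1 σ x t *ᵥ θ.ofLp) :=
      (inv_mulVec_mulVec hA _).symm
    rw [WithLp.ofLp_sub, estimator, response_eq σ r η x θ t hr]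
    conv_lhs => rw [h1]
    rw [← mulVec_sub]
    congr 1
    rw [inv_mulVec_mulVec hA]
    abel
  have e2 : matNorm (gram 1 σ x t) (θ - estimator 1 σ r x t)
      = Real.sqrt (invForm (gram 1 σ x t) (θ.ofLp - (response σ η x t).ofLp)
        (θ.ofLp - (response σ η x t).ofLp)) := by
    rw [matNorm, e, mulVec_inv_mulVec hA, invForm, dotProduct_comm]
  have h2 : Real.sqrt (invForm (gram 1 σ x t) θ.ofLp θ.ofLp) ≤ ‖θ‖ := by
    refine Real.sqrt_le_iff.2 ⟨norm_nonneg _, ?_⟩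
    rw [← dotProduct_self_eq_norm_sq]
    exact invForm_le_dotProduct hA (dotProduct_self_le_gram σ x t) _
  rw [e2]
  linarith [sqrt_invForm_sub_le hA θ.ofLp (response σ η x t).ofLp]

end Gram

/-! ### Measurability -/

section Measurability

open Matrix

variable {Ω : Type*} {m : MeasurableSpace Ω}

lemma measurable_matrix_det {n : Type*} [Fintype n] [DecidableEq n] {A : Ω → Matrix n n ℝ}
    (hA : ∀ i j, Measurable fun ω => A ω i j) : Measurable fun ω => (A ω).det := by
  simp only [Matrix.det_apply']
  fun_prop

/-- Cramer's rule expresses each entry through determinants. -/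
lemma measurable_matrix_inv {n : Type*} [Fintype n] [DecidableEq n] {A : Ω → Matrix n n ℝ}
    (hA : ∀ i j, Measurable fun ω => A ω i j) (i j : n) :
    Measurable fun ω => (A ω)⁻¹ i j := by
  have h : ∀ ω, (A ω)⁻¹ i j = (A ω).det⁻¹ * ((A ω).updateRow j (Pi.single i 1)).det := by
    intro ω
    rw [Matrix.inv_def, Matrix.smul_apply, smul_eq_mul, Ring.inverse_eq_inv', adjugate_apply]
  simp only [h]
  refine (measurable_matrix_det hA).inv.mul (measurable_matrix_det fun k l => ?_)
  by_cases hk : k = j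
  · subst hk; simp
  · simpa [hk] using hA k l

lemma measurable_invForm {n : Type*} [Fintype n] [DecidableEq n] {A : Ω → Matrix n n ℝ}
    {u v : Ω → n → ℝ} (hA : ∀ i j, Measurable fun ω => A ω i j)
    (hu : Measurable u) (hv : Measurable v) : Measurable fun ω => invForm (A ω) (u ω) (v ω) := by
  simp only [invForm, dotProduct, mulVec]
  exact Finset.measurable_fun_sum _ fun i _ => ((measurable_pi_apply i).comp hu).mul
    (Finset.measurable_fun_sum _ fun j _ => (measurable_matrix_inv hA i j).mul
      ((measurable_pi_apply j).comp hv))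

variable {d : ℕ} {σ η : ℕ → Ω → ℝ} {x : ℕ → Ω → EuclideanSpace ℝ (Fin d)} {t : ℕ}

lemma measurable_sigmaBar (hσ : Measurable (σ t)) :
    Measurable fun ω => sigmaBar d (fun s => σ s ω) t := by
  unfold sigmaBar
  fun_prop

lemma measurable_sigmaBarMin (hσ : ∀ s < t + 1, Measurable (σ (s + 1))) :
    Measurable fun ω => sigmaBarMin d (fun s => σ s ω) t := by
  unfold sigmaBarMin
  induction t with
  | zero => simpa using measurable_sigmaBar (hσ 0 (by omega))
  | succ t ih =>
    have h1 := ih fun s hs => hσ s (by omega)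
    have h2 := measurable_sigmaBar (d := d) (hσ (t + 1) (by omega))
    have e : Finset.Icc 1 (t + 1 + 1) = insert (t + 1 + 1) (Finset.Icc 1 (t + 1)) := by
      ext i; simp only [Finset.mem_Icc, Finset.mem_insert]; omega
    have e2 : (fun ω => (Finset.Icc 1 (t + 1 + 1)).inf' ⟨1, by simp⟩
        (sigmaBar d fun s => σ s ω)) = fun ω => min (sigmaBar d (fun s => σ s ω) (t + 1 + 1))
          ((Finset.Icc 1 (t + 1)).inf' ⟨1, by simp⟩ (sigmaBar d fun s => σ s ω)) := by
      funext ω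
      simp only [e]
      exact Finset.inf'_insert _ _
    rw [e2]
    exact h2.min h1

lemma measurable_scaledAction (hσ : Measurable (σ t)) (hx : Measurable (x t)) :
    Measurable fun ω => scaledAction (fun s => σ s ω) (fun s => x s ω) t := by
  have := measurable_sigmaBar (d := d) hσ
  unfold scaledAction
  fun_prop

lemma measurable_gram (hσ : ∀ s < t, Measurable (σ (s + 1)))
    (hx : ∀ s < t, Measurable (x (s + 1))) (i j : Fin d) :
    Measurable fun ω => gram 1 (fun s => σ s ω) (fun s => x s ω) t i j := by
  induction t with
  | zero => simp [gram]
  | succ t ih =>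
    have h1 := ih (fun s hs => hσ s (by omega)) (fun s hs => hx s (by omega))
    have h2 := measurable_scaledAction (hσ t (by omega)) (hx t (by omega))
    simp only [gram_succ, Matrix.add_apply, vecMulVec_apply]
    fun_prop

lemma measurable_response (hσ : ∀ s < t, Measurable (σ (s + 1)))
    (hη : ∀ s < t, Measurable (η (s + 1))) (hx : ∀ s < t, Measurable (x (s + 1))) :
    Measurable fun ω => response (fun s => σ s ω) (fun s => η s ω) (fun s => x s ω) t := by
  induction t with
  | zero => simp [response]
  | succ t ih =>
    have h1 := ih (fun s hs => hσ s (by omega)) (fun s hs => hη s (by omega))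
      (fun s hs => hx s (by omega))
    have h2 := measurable_sigmaBar (d := d) (hσ t (by omega))
    have h3 := hx t (by omega)
    have h4 := hη t (by omega)
    simp only [response]
    fun_prop

end Measurability

/-! ### Self-normalised concentration -/

section Concentration

open Matrix

lemma measure_le_of_lintegral_exp_le {Ω : Type*} {mΩ : MeasurableSpace Ω} {μ : Measure Ω}
    {f : Ω → ℝ} (hf : Measurable f) {C l : ℝ}
    (h : ∫⁻ ω, ENNReal.ofReal (Real.exp (f ω)) ∂μ ≤ ENNReal.ofReal (Real.exp C)) :
    μ {ω | l ≤ f ω} ≤ ENNReal.ofReal (Real.exp (C - l)) := by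
  have h1 := mul_meas_ge_le_lintegral (μ := μ)
    (f := fun ω => ENNReal.ofReal (Real.exp (f ω))) (by fun_prop) (ENNReal.ofReal (Real.exp l))
  have h2 : {ω | l ≤ f ω} = {ω | ENNReal.ofReal (Real.exp l) ≤ ENNReal.ofReal (Real.exp (f ω))} := by
    ext ω
    change l ≤ f ω ↔ ENNReal.ofReal (Real.exp l) ≤ ENNReal.ofReal (Real.exp (f ω))
    rw [ENNReal.ofReal_le_ofReal_iff (Real.exp_pos _).le, Real.exp_le_exp]
  have h0 : ENNReal.ofReal (Real.exp l) ≠ 0 := by simp [Real.exp_pos]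
  rw [h2, Real.exp_sub, ENNReal.ofReal_div_of_pos (Real.exp_pos _),
    ENNReal.le_div_iff_mul_le (Or.inl h0) (Or.inl ENNReal.ofReal_ne_top), mul_comm]
  exact h1.trans h

variable {d : ℕ} {Ω : Type*} {mΩ : MeasurableSpace Ω}

/-- The measurability and noise assumptions on the interaction over the first `T` rounds. -/
structure IsInteraction (T : ℕ) (μ : Measure Ω) (ℱ : Filtration ℕ mΩ)
    (x : ℕ → Ω → EuclideanSpace ℝ (Fin d)) (η σ : ℕ → Ω → ℝ) : Prop where
  measurable_action : ∀ t < T, Measurable[ℱ t] (x (t + 1))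
  norm_action_le : ∀ t < T, ∀ ω, ‖x (t + 1) ω‖ ≤ 1
  measurable_deviation : ∀ t < T, Measurable[ℱ t] (σ (t + 1))
  deviation_nonneg : ∀ t < T, ∀ ω, 0 ≤ σ (t + 1) ω
  measurable_noise : ∀ t < T, Measurable[ℱ (t + 1)] (η (t + 1))
  condSymmetric : ∀ t < T, CondSymmetric (ℱ t) μ (η (t + 1))
  condSubGaussian : ∀ t < T, CondSubGaussian (ℱ t) μ (η (t + 1)) (σ (t + 1))

variable {T : ℕ} {μ : Measure Ω} {ℱ : Filtration ℕ mΩ}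
  {x : ℕ → Ω → EuclideanSpace ℝ (Fin d)} {η σ : ℕ → Ω → ℝ}

/-- The weighted noise sum `∑_{s ≤ t} η_s x_s / σ̄_s ^ 2`. -/
noncomputable def noiseSum (x : ℕ → Ω → EuclideanSpace ℝ (Fin d)) (η σ : ℕ → Ω → ℝ) (t : ℕ)
    (ω : Ω) : EuclideanSpace ℝ (Fin d) :=
  response (fun s => σ s ω) (fun s => η s ω) (fun s => x s ω) t

/-- The Gram matrix as a random matrix. -/
noncomputable def gramRV (x : ℕ → Ω → EuclideanSpace ℝ (Fin d)) (σ : ℕ → Ω → ℝ) (t : ℕ)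
    (ω : Ω) : Matrix (Fin d) (Fin d) ℝ :=
  gram 1 (fun s => σ s ω) (fun s => x s ω) t

/-- The scaled action as a random vector. -/
noncomputable def scaledActionRV (x : ℕ → Ω → EuclideanSpace ℝ (Fin d)) (σ : ℕ → Ω → ℝ) (t : ℕ)
    (ω : Ω) : Fin d → ℝ :=
  scaledAction (fun s => σ s ω) (fun s => x s ω) t

namespace IsInteraction

lemma measurable_noiseSum (H : IsInteraction T μ ℱ x η σ) {t : ℕ} (ht : t ≤ T) :
    Measurable[ℱ t] (noiseSum x η σ t) :=
  measurable_response
    (fun s hs => (H.measurable_deviation s (by omega)).mono (ℱ.mono (by omega)) le_rfl)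
    (fun s hs => (H.measurable_noise s (by omega)).mono (ℱ.mono (by omega)) le_rfl)
    (fun s hs => (H.measurable_action s (by omega)).mono (ℱ.mono (by omega)) le_rfl)

lemma measurable_gramRV (H : IsInteraction T μ ℱ x η σ) {t : ℕ} (ht : t ≤ T)
    (i j : Fin d) :
    Measurable[ℱ t] fun ω => gramRV x σ t ω i j :=
  measurable_gram
    (fun s hs => (H.measurable_deviation s (by omega)).mono (ℱ.mono (by omega)) le_rfl)
    (fun s hs => (H.measurable_action s (by omega)).mono (ℱ.mono (by omega)) le_rfl) i j

lemma measurable_sigmaBarMin (H : IsInteraction T μ ℱ x η σ) {t s : ℕ} (ht : t ≤ s)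
    (hs : t < T) :
    Measurable[ℱ s] fun ω => sigmaBarMin d (fun s => σ s ω) t :=
  WeightedOFUL.measurable_sigmaBarMin
    (fun i hi => (H.measurable_deviation i (by omega)).mono (ℱ.mono (by omega)) le_rfl)

end IsInteraction

end Concentration

/-! ### The two exponential potentials -/

section Supermartingales

open Matrix

variable {d : ℕ} {Ω : Type*} {mΩ : MeasurableSpace Ω} {T : ℕ} {μ : Measure Ω}
  {ℱ : Filtration ℕ mΩ} {x : ℕ → Ω → EuclideanSpace ℝ (Fin d)} {η σ : ℕ → Ω → ℝ}

/-- The logarithm of the determinant-normalised potential. -/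
noncomputable def detPotential (x : ℕ → Ω → EuclideanSpace ℝ (Fin d)) (η σ : ℕ → Ω → ℝ) (t : ℕ)
    (ω : Ω) : ℝ :=
  invForm (gramRV x σ t ω) (noiseSum x η σ t ω).ofLp (noiseSum x η σ t ω).ofLp / 2
    - Real.log (gramRV x σ t ω).det / 2

/-- The logarithm of the potential for the noise sum rescaled by `σ̄_{min}`, over the horizon `n`. -/
noncomputable def normPotential (n : ℕ) (x : ℕ → Ω → EuclideanSpace ℝ (Fin d))
    (η σ : ℕ → Ω → ℝ) (t : ℕ) (ω : Ω) : ℝ :=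
  1 / (2 * (t + n)) * (sigmaBarMin d (fun s => σ s ω) (t - 1) ^ 2 * ‖noiseSum x η σ t ω‖ ^ 2)
    - Real.log (t + n) / 2

lemma noiseSum_succ (x : ℕ → Ω → EuclideanSpace ℝ (Fin d)) (η σ : ℕ → Ω → ℝ) (t : ℕ) (ω : Ω) :
    (noiseSum x η σ (t + 1) ω).ofLp = (noiseSum x η σ t ω).ofLp +
      (η (t + 1) ω / sigmaBar d (fun s => σ s ω) (t + 1)) • scaledActionRV x σ (t + 1) ω := by
  simp only [noiseSum, response, scaledActionRV, scaledAction, WithLp.ofLp_add, WithLp.ofLp_smul,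
    smul_smul]
  congr 2
  ring

/-- Sherman–Morrison and the determinant lemma make the new potential quadratic in the normalised
noise `z`. Its coefficients are known before the noise is drawn, and `q / (1 + q) < 1`, as the
Gaussian bound requires. -/
lemma detPotential_succ (x : ℕ → Ω → EuclideanSpace ℝ (Fin d)) (η σ : ℕ → Ω → ℝ) (t : ℕ) (ω : Ω)
    {p q z : ℝ} (hz : z = η (t + 1) ω / sigmaBar d (fun s => σ s ω) (t + 1))
    (hp : p = invForm (gramRV x σ t ω) (scaledActionRV x σ (t + 1) ω) (noiseSum x η σ t ω).ofLp)
    (hq : q = invForm (gramRV x σ t ω) (scaledActionRV x σ (t + 1) ω)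
      (scaledActionRV x σ (t + 1) ω)) :
    detPotential x η σ (t + 1) ω = (detPotential x η σ t ω - p ^ 2 / (2 * (1 + q))
      - Real.log (1 + q) / 2) + p / (1 + q) * z + q / (1 + q) * z ^ 2 / 2 := by
  have hA : (gramRV x σ t ω).PosDef := gram_posDef _ _ _
  have hq0 : 0 ≤ q := hq ▸ invForm_nonneg hA _
  have hl : Real.log (gramRV x σ (t + 1) ω).det
      = Real.log (gramRV x σ t ω).det + Real.log (1 + q) := by
    rw [hq]; exact log_det_gram_succ _ _ _
  have hg : gramRV x σ (t + 1) ω = gramRV x σ t ω +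
      vecMulVec (scaledActionRV x σ (t + 1) ω) (scaledActionRV x σ (t + 1) ω) := gram_succ _ _ _ _
  have hw : invForm (gramRV x σ t ω) (scaledActionRV x σ (t + 1) ω)
      ((noiseSum x η σ t ω).ofLp + z • scaledActionRV x σ (t + 1) ω) = p + z * q := by
    rw [hp, hq]
    simp only [invForm, mulVec_add, mulVec_smul, dotProduct_add, dotProduct_smul, smul_eq_mul]
  have hn : invForm (gramRV x σ t ω)
      ((noiseSum x η σ t ω).ofLp + z • scaledActionRV x σ (t + 1) ω)
      ((noiseSum x η σ t ω).ofLp + z • scaledActionRV x σ (t + 1) ω)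
      = invForm (gramRV x σ t ω) (noiseSum x η σ t ω).ofLp (noiseSum x η σ t ω).ofLp
        + 2 * z * p + z ^ 2 * q := by
    have hc := invForm_comm hA (noiseSum x η σ t ω).ofLp (scaledActionRV x σ (t + 1) ω)
    rw [← hp] at hc
    have : invForm (gramRV x σ t ω)
      ((noiseSum x η σ t ω).ofLp + z • scaledActionRV x σ (t + 1) ω)
      ((noiseSum x η σ t ω).ofLp + z • scaledActionRV x σ (t + 1) ω)
      = invForm (gramRV x σ t ω) (noiseSum x η σ t ω).ofLp (noiseSum x η σ t ω).ofLp
        + z * invForm (gramRV x σ t ω) (noiseSum x η σ t ω).ofLp (scaledActionRV x σ (t + 1) ω)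
        + z * invForm (gramRV x σ t ω) (scaledActionRV x σ (t + 1) ω)
            ((noiseSum x η σ t ω).ofLp + z • scaledActionRV x σ (t + 1) ω) := by
      simp only [invForm, mulVec_add, mulVec_smul, dotProduct_add, dotProduct_smul, smul_eq_mul,
        add_dotProduct, smul_dotProduct]
      ring
    rw [this, hw, hc]
    ring
  rw [detPotential, hl, noiseSum_succ, ← hz, hg, invForm_add_vecMulVec hA, hw, ← hq, hn,
    detPotential]
  field_simp
  ring

lemma IsInteraction.measurable_detPotential (H : IsInteraction T μ ℱ x η σ) {t : ℕ}
    (ht : t ≤ T) : Measurable[ℱ t] (detPotential x η σ t) := by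
  have h1 := H.measurable_gramRV ht
  have h2 : Measurable[ℱ t] fun ω => (noiseSum x η σ t ω).ofLp :=
    (WithLp.measurable_ofLp 2 (Fin d → ℝ)).comp (H.measurable_noiseSum ht)
  exact ((measurable_invForm h1 h2 h2).div_const 2).sub
    ((Real.measurable_log.comp (measurable_matrix_det h1)).div_const 2)

/-- Here `1 - b = 1 / (1 + q)`, so the Gaussian factor cancels both correction terms of
`detPotential_succ` exactly. -/
lemma IsInteraction.lintegral_exp_detPotential_succ_le [IsProbabilityMeasure μ] (hd : 1 ≤ d)
    (H : IsInteraction T μ ℱ x η σ) {t : ℕ} (ht : t < T) :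
    ∫⁻ ω, ENNReal.ofReal (Real.exp (detPotential x η σ (t + 1) ω)) ∂μ
      ≤ ∫⁻ ω, ENNReal.ofReal (Real.exp (detPotential x η σ t ω)) ∂μ := by
  have h1 := H.measurable_gramRV ht.le
  have h2 : Measurable[ℱ t] fun ω => (noiseSum x η σ t ω).ofLp :=
    (WithLp.measurable_ofLp 2 (Fin d → ℝ)).comp (H.measurable_noiseSum ht.le)
  have h3 : Measurable[ℱ t] (scaledActionRV x σ (t + 1)) :=
    measurable_scaledAction (H.measurable_deviation t ht) (H.measurable_action t ht)
  set p : Ω → ℝ := fun ω =>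
    invForm (gramRV x σ t ω) (scaledActionRV x σ (t + 1) ω) (noiseSum x η σ t ω).ofLp with hp
  set q : Ω → ℝ := fun ω => invForm (gramRV x σ t ω) (scaledActionRV x σ (t + 1) ω)
      (scaledActionRV x σ (t + 1) ω) with hq
  have hpm : Measurable[ℱ t] p := measurable_invForm h1 h3 h2
  have hqm : Measurable[ℱ t] q := measurable_invForm h1 h3 h3
  have hq0 : ∀ ω, 0 ≤ q ω := fun ω => invForm_nonneg (gram_posDef _ _ _) _
  have h1q : Measurable[ℱ t] fun ω => 1 + q ω := measurable_const.add hqm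
  refine le_trans (le_of_eq (lintegral_congr fun ω => ?_))
    (((H.condSubGaussian t ht).lintegral_exp_quadratic_le (ℱ.le t)
      ((H.measurable_noise t ht).mono (ℱ.le _) le_rfl) (H.measurable_deviation t ht)
      (H.deviation_nonneg t ht) (H.condSymmetric t ht)
      (s := fun ω => sigmaBar d (fun s => σ s ω) (t + 1))
      (a := fun ω => p ω / (1 + q ω)) (b := fun ω => q ω / (1 + q ω))
      (c := fun ω => detPotential x η σ t ω - p ω ^ 2 / (2 * (1 + q ω)) - Real.log (1 + q ω) / 2)
      (measurable_sigmaBar (H.measurable_deviation t ht)) (hpm.div h1q) (hqm.div h1q)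
      (((H.measurable_detPotential ht.le).sub ((hpm.pow_const 2).div (h1q.const_mul 2))).sub
        ((Real.measurable_log.comp h1q).div_const 2))
      (fun ω => sigmaBar_pos hd _ _) (fun ω => le_max_right _ _)
      (fun ω => div_nonneg (hq0 ω) (by linarith [hq0 ω]))
      (fun ω => (div_lt_one (by linarith [hq0 ω])).2 (by linarith))).trans
      (le_of_eq (lintegral_congr fun ω => ?_)))
  · rw [detPotential_succ x η σ t ω rfl rfl rfl]
  · have h0 : 0 < 1 + q ω := by linarith [hq0 ω]
    have e1 : 1 - q ω / (1 + q ω) = (1 + q ω)⁻¹ := by field_simp; ring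
    have e2 : Real.sqrt ((1 + q ω)⁻¹) = Real.exp (-(Real.log (1 + q ω)) / 2) := by
      rw [Real.exp_half, Real.exp_neg, Real.exp_log h0]
    rw [e1, e2, ← Real.exp_sub]
    congr 2
    field_simp
    ring

lemma IsInteraction.lintegral_exp_detPotential_le [IsProbabilityMeasure μ] (hd : 1 ≤ d)
    (H : IsInteraction T μ ℱ x η σ) {t : ℕ} (ht : t ≤ T) :
    ∫⁻ ω, ENNReal.ofReal (Real.exp (detPotential x η σ t ω)) ∂μ
      ≤ ENNReal.ofReal (Real.exp 0) := by
  induction t with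
  | zero => simp [detPotential, noiseSum, response, invForm, gramRV, gram]
  | succ t ih => exact (H.lintegral_exp_detPotential_succ_le hd (by omega)).trans (ih (by omega))

lemma norm_noiseSum_succ_sq (x : ℕ → Ω → EuclideanSpace ℝ (Fin d)) (η σ : ℕ → Ω → ℝ) (t : ℕ)
    (ω : Ω) {z s : ℝ} (hs : s = sigmaBar d (fun s => σ s ω) (t + 1)) (hz : z = η (t + 1) ω / s) :
    ‖noiseSum x η σ (t + 1) ω‖ ^ 2 = ‖noiseSum x η σ t ω‖ ^ 2
      + 2 * (inner ℝ (noiseSum x η σ t ω) (x (t + 1) ω) / s) * z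
      + (‖x (t + 1) ω‖ / s) ^ 2 * z ^ 2 := by
  have e : noiseSum x η σ (t + 1) ω = noiseSum x η σ t ω + (z / s) • x (t + 1) ω := by
    simp only [noiseSum, response, hz, hs]
    congr 2
    ring
  rw [e, norm_add_sq_real, inner_smul_right, norm_smul, mul_pow, Real.norm_eq_abs, sq_abs]
  ring

lemma IsInteraction.measurable_normPotential (H : IsInteraction T μ ℱ x η σ) {n t : ℕ}
    (hn : 1 ≤ T) (ht : t ≤ T) : Measurable (normPotential n x η σ t) := by
  have h1 : Measurable (noiseSum x η σ t) := (H.measurable_noiseSum ht).mono (ℱ.le _) le_rfl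
  have h2 : Measurable fun ω => sigmaBarMin d (fun s => σ s ω) (t - 1) :=
    (H.measurable_sigmaBarMin (s := t - 1) le_rfl (by omega)).mono (ℱ.le _) le_rfl
  unfold normPotential
  fun_prop

/-- After scaling by `σ̄_min` each increment direction has norm at most `1`, so the step compares
`exp (m S / (2 (N + 1))) / √(N + 1)` with `exp (m S / (2 N)) / √N`; the terms match since `1 / (N +
1) + 1 / (N (N + 1)) = 1 / N`. -/
lemma IsInteraction.lintegral_exp_normPotential_succ_le [IsProbabilityMeasure μ] (hd : 1 ≤ d)
    (H : IsInteraction T μ ℱ x η σ) {n t : ℕ} (hn : 1 ≤ n) (ht : t < T) :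
    ∫⁻ ω, ENNReal.ofReal (Real.exp (normPotential n x η σ (t + 1) ω)) ∂μ
      ≤ ∫⁻ ω, ENNReal.ofReal (Real.exp (normPotential n x η σ t ω)) ∂μ := by
  have hn0 : (1 : ℝ) ≤ n := by exact_mod_cast hn
  set N : ℝ := t + n with hN
  have hN1 : 1 ≤ N := by have : (0 : ℝ) ≤ t := by positivity
                         linarith
  set S : Ω → ℝ := fun ω => ‖noiseSum x η σ t ω‖ ^ 2 with hS
  set s : Ω → ℝ := fun ω => sigmaBar d (fun s => σ s ω) (t + 1) with hs
  set m : Ω → ℝ := fun ω => sigmaBarMin d (fun s => σ s ω) t ^ 2 with hm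
  set u : Ω → ℝ := fun ω => inner ℝ (noiseSum x η σ t ω) (x (t + 1) ω) / s ω with hu
  set v : Ω → ℝ := fun ω => ‖x (t + 1) ω‖ / s ω with hv
  have hmS := H.measurable_noiseSum ht.le
  have hSm : Measurable[ℱ t] S := (measurable_norm.comp hmS).pow_const 2
  have hsm : Measurable[ℱ t] s := measurable_sigmaBar (H.measurable_deviation t ht)
  have hmm : Measurable[ℱ t] m := (H.measurable_sigmaBarMin le_rfl ht).pow_const 2
  have hum : Measurable[ℱ t] u := (hmS.inner (H.measurable_action t ht)).div hsm
  have hvm : Measurable[ℱ t] v := (measurable_norm.comp (H.measurable_action t ht)).div hsm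
  have hs0 : ∀ ω, 0 < s ω := fun ω => sigmaBar_pos hd _ _
  have hm0 : ∀ ω, 0 ≤ m ω := fun ω => sq_nonneg _
  have hms : ∀ ω, m ω ≤ s ω ^ 2 := fun ω =>
    pow_le_pow_left₀ (sigmaBarMin_pos hd _ _).le
      (sigmaBarMin_le _ (by omega) le_rfl) 2
  have hmv : ∀ ω, m ω * v ω ^ 2 ≤ 1 := fun ω => by
    have h1 : ‖x (t + 1) ω‖ ^ 2 ≤ 1 :=
      pow_le_one₀ (norm_nonneg _) (H.norm_action_le t ht ω)
    rw [hv]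
    simp only [div_pow]
    rw [← mul_div_assoc, div_le_one (pow_pos (hs0 ω) 2)]
    nlinarith [hms ω, hm0 ω]
  have huv : ∀ ω, u ω ^ 2 ≤ S ω * v ω ^ 2 := fun ω => by
    have h1 := abs_real_inner_le_norm (noiseSum x η σ t ω) (x (t + 1) ω)
    have h2 := pow_le_pow_left₀ (abs_nonneg _) h1 2
    rw [sq_abs, mul_pow] at h2
    simp only [hu, hv, hS, div_pow]
    rw [← mul_div_assoc]
    gcongr
  have hlam : 1 / (N + 1) < 1 := by rw [div_lt_one (by linarith)]; linarith
  have hb : ∀ ω, m ω * v ω ^ 2 / (N + 1) ≤ 1 / (N + 1) := fun ω => by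
    gcongr; exact hmv ω
  refine le_trans (le_of_eq (lintegral_congr fun ω => ?_))
    (((H.condSubGaussian t ht).lintegral_exp_quadratic_le (ℱ.le t)
      ((H.measurable_noise t ht).mono (ℱ.le _) le_rfl) (H.measurable_deviation t ht)
      (H.deviation_nonneg t ht) (H.condSymmetric t ht) (s := s)
      (a := fun ω => m ω * u ω / (N + 1)) (b := fun ω => m ω * v ω ^ 2 / (N + 1))
      (c := fun ω => m ω * S ω / (2 * (N + 1)) - Real.log (N + 1) / 2)
      hsm ((hmm.mul hum).div_const _) ((hmm.mul (hvm.pow_const 2)).div_const _)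
      (((hmm.mul hSm).div_const _).sub_const _) hs0 (fun ω => le_max_right _ _)
      (fun ω => by have := hm0 ω; positivity)
      (fun ω => (hb ω).trans_lt hlam)).trans (lintegral_mono fun ω => ?_))
  · rw [normPotential, norm_noiseSum_succ_sq x η σ t ω rfl rfl]
    congr 2
    have e : ((t + 1 : ℕ) : ℝ) + n = N + 1 := by push_cast; rw [hN]; ring
    rw [e, Nat.add_sub_cancel]
    change 1 / (2 * (N + 1)) * (m ω * (S ω + 2 * u ω * (η (t + 1) ω / s ω)
      + v ω ^ 2 * (η (t + 1) ω / s ω) ^ 2)) - Real.log (N + 1) / 2 = _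
    field_simp
    ring
  · refine ENNReal.ofReal_le_ofReal ?_
    have hN1' : 1 - 1 / (N + 1) = N / (N + 1) := by field_simp; ring
    have h1b : N / (N + 1) ≤ 1 - m ω * v ω ^ 2 / (N + 1) := by rw [← hN1']; linarith [hb ω]
    have hpos : 0 < N / (N + 1) := by positivity
    have e2 : Real.sqrt (N / (N + 1)) = Real.exp ((Real.log N - Real.log (N + 1)) / 2) := by
      rw [Real.exp_half, Real.exp_sub, Real.exp_log (by linarith), Real.exp_log (by linarith)]
    have hS0 : 0 ≤ S ω := sq_nonneg _
    have ha : (m ω * u ω / (N + 1)) ^ 2 / (2 * (1 - m ω * v ω ^ 2 / (N + 1)))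
        ≤ m ω * S ω / (N + 1) ^ 2 / (2 * (N / (N + 1))) := by
      have h1 : (m ω * u ω) ^ 2 ≤ m ω * S ω := by
        calc (m ω * u ω) ^ 2 = m ω ^ 2 * u ω ^ 2 := by ring
          _ ≤ m ω ^ 2 * (S ω * v ω ^ 2) := by gcongr; exact huv ω
          _ = m ω * S ω * (m ω * v ω ^ 2) := by ring
          _ ≤ m ω * S ω * 1 := by
            have := hm0 ω
            gcongr; exact hmv ω
          _ = _ := mul_one _
      rw [div_pow]
      gcongr
    -- The running minimum only decreases, which is the favourable direction. At `t = 0` truncated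
    -- subtraction makes both indices `0`.
    have hmono : m ω ≤ sigmaBarMin d (fun s => σ s ω) (t - 1) ^ 2 := by
      refine pow_le_pow_left₀ (sigmaBarMin_pos hd _ _).le ?_ 2
      cases t with
      | zero => exact le_rfl
      | succ t => exact sigmaBarMin_succ_le _ _
    calc _ ≤ Real.exp (m ω * S ω / (2 * (N + 1)) - Real.log (N + 1) / 2
          + m ω * S ω / (N + 1) ^ 2 / (2 * (N / (N + 1)))) / Real.sqrt (N / (N + 1)) := by
          gcongr
      _ = Real.exp (m ω * S ω / (2 * N) - Real.log N / 2) := by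
          rw [e2, ← Real.exp_sub]
          congr 1
          field_simp
          ring
      _ ≤ _ := by
          rw [Real.exp_le_exp, normPotential, ← hN, one_div_mul_eq_div]
          gcongr

lemma IsInteraction.lintegral_exp_normPotential_le [IsProbabilityMeasure μ] (hd : 1 ≤ d)
    (H : IsInteraction T μ ℱ x η σ) {n t : ℕ} (hn : 1 ≤ n) (ht : t ≤ T) :
    ∫⁻ ω, ENNReal.ofReal (Real.exp (normPotential n x η σ t ω)) ∂μ
      ≤ ENNReal.ofReal (Real.exp (-Real.log n / 2)) := by
  induction t with
  | zero => simp [normPotential, noiseSum, response, neg_div]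
  | succ t ih =>
    exact (H.lintegral_exp_normPotential_succ_le hd hn (by omega)).trans (ih (by omega))

end Supermartingales

/-! ### Validity of the confidence radius -/

section Confidence

open Matrix

variable {d : ℕ} {Ω : Type*} {mΩ : MeasurableSpace Ω} {T : ℕ} {μ : Measure Ω}
  {ℱ : Filtration ℕ mΩ} {x : ℕ → Ω → EuclideanSpace ℝ (Fin d)} {η σ : ℕ → Ω → ℝ}

lemma one_le_log_confidence {δ : ℝ} (hδ : 0 < δ) (hδ1 : δ ≤ 1) (t : ℕ) :
    2 * Real.log 2 ≤ Real.log (4 * (t + 1 : ℝ) ^ 2 / δ) := by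
  have h : 2 * Real.log 2 = Real.log 4 := by
    rw [show (4 : ℝ) = 2 ^ 2 by norm_num, Real.log_pow]; norm_num
  rw [h]
  refine Real.log_le_log (by norm_num) ?_
  rw [le_div_iff₀ hδ]
  have ht : (0 : ℝ) ≤ t := by positivity
  nlinarith

lemma IsInteraction.sqrt_invForm_noiseSum_le (hd : 1 ≤ d) (H : IsInteraction T μ ℱ x η σ)
    {t : ℕ} (ht : t < T) {δ : ℝ} (hδ : 0 < δ) (hδ1 : δ ≤ 1) {ω : Ω}
    (h1 : detPotential x η σ (t + 1) ω < Real.log (4 * (t + 1 : ℝ) ^ 2 / δ))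
    (h2 : normPotential (t + 1) x η σ (t + 1) ω
      < Real.log (4 * (t + 1 : ℝ) ^ 2 / δ) - Real.log (t + 1) / 2) :
    Real.sqrt (invForm (gramRV x σ (t + 1) ω) (noiseSum x η σ (t + 1) ω).ofLp
      (noiseSum x η σ (t + 1) ω).ofLp) ≤ radius d 1 δ (fun s => σ s ω) (t + 1) := by
  have hl := one_le_log_confidence hδ hδ1 t
  have hlog2 := Real.log_two_gt_d9
  have hd0 : (0 : ℝ) < d := by exact_mod_cast hd
  have hA : (gramRV x σ (t + 1) ω).PosDef := gram_posDef _ _ _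
  rw [radius, mul_one, show (8 : ℝ) = Real.sqrt 64 by
    rw [show (64 : ℝ) = 8 ^ 2 by norm_num, Real.sqrt_sq (by norm_num)], ← Real.sqrt_mul (by norm_num)]
  refine Real.sqrt_le_sqrt ?_
  set l := Real.log (4 * (t + 1 : ℝ) ^ 2 / δ) with hld
  set m := sigmaBarMin d (fun s => σ s ω) t ^ 2 with hm
  have hm0 : 0 < m := pow_pos (sigmaBarMin_pos hd _ _) 2
  set n : ℝ := t + 1 with hn
  have hn1 : 1 ≤ n := by have : (0 : ℝ) ≤ t := by positivity
                         linarith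
  set y := n / (d * m) with hy
  have hy0 : 0 < y := by positivity
  have hdy : d * y = n / m := by rw [hy]; field_simp
  set L := Real.log (1 + y) with hL
  set S := noiseSum x η σ (t + 1) ω with hS
  set Q := invForm (gramRV x σ (t + 1) ω) S.ofLp S.ofLp with hQ
  -- For `y ≤ 1` the logarithm `L` is comparable to `y` and the Euclidean bound is used; for `y > 1`
  -- it is at least `log 2`, and the determinant bound suffices.
  rcases le_or_gt y 1 with hy1 | hy1
  · have hLy : y / 2 ≤ L := by
      refine le_trans ?_ (Real.one_sub_inv_le_log_of_pos (show 0 < 1 + y by linarith))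
      rw [show 1 - (1 + y)⁻¹ = y / (1 + y) by field_simp; ring]
      gcongr
      linarith
    have hQS : Q ≤ ‖S‖ ^ 2 := by
      rw [← dotProduct_self_eq_norm_sq]
      exact invForm_le_dotProduct hA (dotProduct_self_le_gram _ _ _) _
    have e : Real.log (n + n) = Real.log 2 + Real.log n := by
      rw [← two_mul, Real.log_mul (by norm_num) (by linarith)]
    rw [normPotential, Nat.add_sub_cancel] at h2
    push_cast at h2
    rw [← hn, ← hm, ← hS, e] at h2
    -- With horizon equal to time, the normalisations differ by only `log 2 / 2`, which is at most
    -- `l / 4`.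
    have h3 : 1 / (2 * (n + n)) * (m * ‖S‖ ^ 2) < 5 / 4 * l := by linarith
    rw [one_div_mul_eq_div, div_lt_iff₀ (by linarith)] at h3
    have h4 : ‖S‖ ^ 2 ≤ 5 * (n / m) * l := by
      rw [← mul_div_assoc, div_mul_eq_mul_div, le_div_iff₀ hm0]
      linarith
    rw [← hdy] at h4
    have h5 : d * y * l ≤ 2 * (d * L * l) := by
      have : d * y * l ≤ d * (2 * L) * l := by
        gcongr
        · linarith
        · linarith
      linarith
    have h6 : 0 ≤ d * L * l := by
      have : 0 ≤ L := by linarith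
      have : 0 ≤ l := by linarith
      positivity
    linarith
  · have hL2 : Real.log 2 ≤ L := Real.log_le_log (by norm_num) (by linarith)
    have hdet : Real.log (gramRV x σ (t + 1) ω).det ≤ d * L := by
      have := log_det_gram_le hd (fun s => σ s ω) (fun s => x s ω) hm0 (t + 1)
        (fun s hs => H.norm_action_le s (by omega) ω) (fun s hs =>
          pow_le_pow_left₀ (sigmaBarMin_pos hd _ _).le
            (sigmaBarMin_le _ (by omega) (by omega)) 2)
      push_cast at this
      exact this
    rw [detPotential] at h1
    have h3 : Q < 2 * l + d * L := by linarith
    have hd1 : (1 : ℝ) ≤ d := by exact_mod_cast hd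
    have hdL : 1 / 2 ≤ d * L := by nlinarith
    have h4 : 2 * l ≤ 4 * (d * L * l) := by nlinarith
    have h5 : d * L ≤ d * L * l := by nlinarith
    linarith

/-- The term `1 / T` makes the induction close; only the bound `2` is needed. -/
lemma sum_inv_sq_le {T : ℕ} (hT : 1 ≤ T) :
    (∑ t ∈ Finset.range T, 1 / ((t : ℝ) + 1) ^ 2 : ℝ) ≤ 2 - 1 / T := by
  induction T, hT using Nat.le_induction with
  | base => norm_num
  | succ n hn ih =>
    rw [Finset.sum_range_succ]
    have hn0 : (1 : ℝ) ≤ n := by exact_mod_cast hn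
    have : 1 / ((n : ℝ) + 1) ^ 2 ≤ 1 / n - 1 / (n + 1) := by
      rw [div_sub_div _ _ (by positivity) (by positivity), div_le_div_iff₀ (by positivity)
        (by positivity)]
      nlinarith
    push_cast
    linarith

/-- With probability at least `1 - δ`, all confidence radii dominate the self-normalised noise. -/
lemma IsInteraction.exists_confidence_event [IsProbabilityMeasure μ] (hd : 1 ≤ d) (hT : 1 ≤ T)
    (H : IsInteraction T μ ℱ x η σ) {δ : ℝ} (hδ : 0 < δ) (hδ1 : δ ≤ 1) :
    ∃ E : Set Ω, μ E ≤ ENNReal.ofReal δ ∧ ∀ ω ∉ E, ∀ t < T,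
      Real.sqrt (invForm (gramRV x σ (t + 1) ω) (noiseSum x η σ (t + 1) ω).ofLp
        (noiseSum x η σ (t + 1) ω).ofLp) ≤ radius d 1 δ (fun s => σ s ω) (t + 1) := by
  set l : ℕ → ℝ := fun t => Real.log (4 * (t + 1 : ℝ) ^ 2 / δ) with hl
  set E₁ : ℕ → Set Ω := fun t => {ω | l t ≤ detPotential x η σ (t + 1) ω} with hE₁
  set E₂ : ℕ → Set Ω := fun t =>
    {ω | l t - Real.log (t + 1) / 2 ≤ normPotential (t + 1) x η σ (t + 1) ω} with hE₂
  -- Each bad event costs `δ / (4 (t + 1)²)`; two per round, summed with `∑ 1 / (t + 1)² ≤ 2`, give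
  -- `δ`.
  have hexp : ∀ t, Real.exp (-l t) = δ / 4 * (1 / ((t : ℝ) + 1) ^ 2) := by
    intro t
    rw [Real.exp_neg, Real.exp_log (by positivity)]
    field_simp
  have b1 : ∀ t < T, μ (E₁ t) ≤ ENNReal.ofReal (Real.exp (-l t)) := by
    intro t ht
    have := measure_le_of_lintegral_exp_le (l := l t)
      ((H.measurable_detPotential (t := t + 1) (by omega)).mono (ℱ.le _) le_rfl)
      (H.lintegral_exp_detPotential_le hd (t := t + 1) (by omega))
    rwa [zero_sub] at this
  have b2 : ∀ t < T, μ (E₂ t) ≤ ENNReal.ofReal (Real.exp (-l t)) := by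
    intro t ht
    have := measure_le_of_lintegral_exp_le (l := l t - Real.log (t + 1) / 2)
      (H.measurable_normPotential (n := t + 1) (t := t + 1) hT (by omega))
      (H.lintegral_exp_normPotential_le hd (n := t + 1) (t := t + 1) (by omega) (by omega))
    push_cast at this
    rwa [show -Real.log ((t : ℝ) + 1) / 2 - (l t - Real.log (t + 1) / 2) = -l t by ring] at this
  refine ⟨⋃ t ∈ Finset.range T, (E₁ t ∪ E₂ t), ?_, ?_⟩
  · calc μ (⋃ t ∈ Finset.range T, (E₁ t ∪ E₂ t))
        ≤ ∑ t ∈ Finset.range T, μ (E₁ t ∪ E₂ t) := measure_biUnion_finset_le _ _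
      _ ≤ ∑ t ∈ Finset.range T, ENNReal.ofReal (δ / 2 * (1 / ((t : ℝ) + 1) ^ 2)) := by
          refine Finset.sum_le_sum fun t ht => ?_
          have ht' := Finset.mem_range.1 ht
          refine (measure_union_le _ _).trans ((add_le_add (b1 t ht') (b2 t ht')).trans ?_)
          rw [← ENNReal.ofReal_add (Real.exp_pos _).le (Real.exp_pos _).le, hexp]
          refine ENNReal.ofReal_le_ofReal (le_of_eq ?_)
          ring
      _ = ENNReal.ofReal (δ / 2 * ∑ t ∈ Finset.range T, (1 / ((t : ℝ) + 1) ^ 2)) := by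
          rw [← ENNReal.ofReal_sum_of_nonneg (fun t _ => by positivity), Finset.mul_sum]
      _ ≤ ENNReal.ofReal δ := by
          refine ENNReal.ofReal_le_ofReal ?_
          have h1 := sum_inv_sq_le hT
          have h2 : (0 : ℝ) ≤ 1 / T := by positivity
          nlinarith
  · intro ω hω t ht
    have hnot : ω ∉ E₁ t ∪ E₂ t := fun h =>
      hω (Set.mem_biUnion (Finset.mem_coe.2 (Finset.mem_range.2 ht)) h)
    refine H.sqrt_invForm_noiseSum_le hd ht hδ hδ1 ?_ ?_
    · exact not_le.1 fun h => hnot (Or.inl h)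
    · exact not_le.1 fun h => hnot (Or.inr h)

end Confidence

/-! ### Regret on the confidence event -/

section Regret

open Matrix

variable {d : ℕ}

lemma inner_le_of_mem_confidenceSet {δ : ℝ} {σ r : ℕ → ℝ} {x : ℕ → EuclideanSpace ℝ (Fin d)}
    {t : ℕ} {θ θ' : EuclideanSpace ℝ (Fin d)} (hθ : θ ∈ confidenceSet 1 1 δ σ r x t)
    (hθ' : θ' ∈ confidenceSet 1 1 δ σ r x t) (y : EuclideanSpace ℝ (Fin d)) :
    inner ℝ y θ ≤ inner ℝ y θ'
      + 2 * (radius d 1 δ σ t + 1) * Real.sqrt (invForm (gram 1 σ x t) y.ofLp y.ofLp) := by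
  have hA := gram_posDef σ x t
  have key : ∀ θ ∈ confidenceSet 1 1 δ σ r x t, |inner ℝ y (θ - estimator 1 σ r x t)|
      ≤ Real.sqrt (invForm (gram 1 σ x t) y.ofLp y.ofLp) * (radius d 1 δ σ t + 1) := by
    intro θ hθ
    have h : matNorm (gram 1 σ x t) (θ - estimator 1 σ r x t)
        ≤ radius d 1 δ σ t + Real.sqrt 1 * 1 := hθ
    rw [Real.sqrt_one, mul_one] at h
    rw [inner_eq_dotProduct]
    exact (abs_dotProduct_le hA _ _).trans (mul_le_mul_of_nonneg_left h (Real.sqrt_nonneg _))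
  have h1 := (abs_le.1 (key θ hθ)).2
  have h2 := (abs_le.1 (key θ' hθ')).1
  rw [inner_sub_right] at h1 h2
  linarith

/-- Optimism: the value of `y` is at most its optimistic value, hence at most that of `z`, which
exceeds the true value of `z` by at most the width of the ellipsoid in direction `z`. -/
lemma inner_le_of_isMaxOn {δ : ℝ} {σ r : ℕ → ℝ} {x : ℕ → EuclideanSpace ℝ (Fin d)}
    {t : ℕ} {θ y z : EuclideanSpace ℝ (Fin d)} (hθ : θ ∈ confidenceSet 1 1 δ σ r x t)
    (hz : IsMaxOn (optimisticValue 1 1 δ σ r x t) (actionSet d) z) (hy : y ∈ actionSet d) :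
    inner ℝ y θ ≤ inner ℝ z θ
      + 2 * (radius d 1 δ σ t + 1) * Real.sqrt (invForm (gram 1 σ x t) z.ofLp z.ofLp) := by
  have h1 : inner ℝ y θ ≤ optimisticValue 1 1 δ σ r x t y := by
    -- The real supremum needs an upper bound; the width in direction `y` provides one.
    refine le_csSup ⟨inner ℝ y θ + 2 * (radius d 1 δ σ t + 1) *
      Real.sqrt (invForm (gram 1 σ x t) y.ofLp y.ofLp), ?_⟩ (Set.mem_image_of_mem _ hθ)
    rintro _ ⟨θ', hθ', rfl⟩
    exact inner_le_of_mem_confidenceSet hθ' hθ y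
  refine h1.trans ((hz hy).trans ?_)
  refine csSup_le (Set.Nonempty.image _ ⟨θ, hθ⟩) ?_
  rintro _ ⟨θ', hθ', rfl⟩
  exact inner_le_of_mem_confidenceSet hθ' hθ z

lemma radius_le (hd : 1 ≤ d) {δ : ℝ} (hδ : 0 < δ) (hδ1 : δ ≤ 1) (σ : ℕ → ℝ) {t T : ℕ}
    (ht : t ≤ T) :
    radius d 1 δ σ t
      ≤ 8 * Real.sqrt (d * Real.log (1 + T) * Real.log (4 * (T : ℝ) ^ 2 / δ)) := by
  cases t with
  | zero => exact mul_nonneg (by norm_num) (Real.sqrt_nonneg _)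
  | succ t =>
    have hd0 : (0 : ℝ) < d := by exact_mod_cast hd
    have hT : (t + 1 : ℝ) ≤ T := by exact_mod_cast ht
    have ht0 : (0 : ℝ) ≤ t := by positivity
    have hm := one_le_mul_sigmaBarMin_sq hd σ t
    have hl := one_le_log_confidence hδ hδ1 t
    have hlog2 := Real.log_two_gt_d9
    have h1 : (t + 1 : ℝ) / (d * 1 * sigmaBarMin d σ t ^ 2) ≤ T := by
      rw [mul_one]
      exact (div_le_self (by positivity) hm).trans hT
    have h2 : 0 < (t + 1 : ℝ) / (d * 1 * sigmaBarMin d σ t ^ 2) := by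
      rw [mul_one]; positivity
    have hA : 0 ≤ Real.log (4 * (t + 1 : ℝ) ^ 2 / δ) := by linarith
    have hB : 0 ≤ Real.log (1 + T) := Real.log_nonneg (by linarith)
    have hC : Real.log (1 + (t + 1 : ℝ) / (d * 1 * sigmaBarMin d σ t ^ 2)) ≤ Real.log (1 + T) :=
      Real.log_le_log (by linarith) (by linarith)
    have hD : Real.log (4 * (t + 1 : ℝ) ^ 2 / δ) ≤ Real.log (4 * (T : ℝ) ^ 2 / δ) := by
      gcongr
    rw [radius]
    gcongr

lemma sum_Icc_one_eq_sum_range (f : ℕ → ℝ) (T : ℕ) :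
    ∑ t ∈ Finset.Icc 1 T, f t = ∑ t ∈ Finset.range T, f (t + 1) := by
  induction T with
  | zero => simp
  | succ T ih => rw [Finset.sum_Icc_succ_top (by omega), ih, Finset.sum_range_succ]

lemma regret_le_of_forall {θ : EuclideanSpace ℝ (Fin d)} {T : ℕ}
    {x : ℕ → EuclideanSpace ℝ (Fin d)} {f : ℕ → ℝ}
    (h : ∀ y ∈ actionSet d, ∀ t < T, inner ℝ y θ - inner ℝ (x (t + 1)) θ ≤ f t) :
    regret θ T x ≤ ∑ t ∈ Finset.range T, f t := by
  rw [regret, sub_le_iff_le_add]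
  refine csSup_le (Set.Nonempty.image _ ⟨0, by simp [actionSet]⟩) ?_
  rintro _ ⟨y, hy, rfl⟩
  dsimp only
  rw [sum_Icc_one_eq_sum_range, sum_Icc_one_eq_sum_range, ← Finset.sum_add_distrib]
  refine Finset.sum_le_sum fun t ht => ?_
  linarith [h y hy t (Finset.mem_range.1 ht)]

lemma inner_sub_inner_le_two {θ y z : EuclideanSpace ℝ (Fin d)} (hθ : ‖θ‖ ≤ 1)
    (hy : ‖y‖ ≤ 1) (hz : ‖z‖ ≤ 1) : inner ℝ y θ - inner ℝ z θ ≤ 2 := by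
  have h : ∀ v : EuclideanSpace ℝ (Fin d), ‖v‖ ≤ 1 → |inner ℝ v θ| ≤ 1 := fun v hv =>
    (abs_real_inner_le_norm v θ).trans (mul_le_one₀ hv (norm_nonneg _) hθ)
  linarith [(abs_le.1 (h y hy)).2, (abs_le.1 (h z hz)).1]

lemma regret_le_two_mul {θ : EuclideanSpace ℝ (Fin d)} (hθ : ‖θ‖ ≤ 1) {T : ℕ}
    {x : ℕ → EuclideanSpace ℝ (Fin d)} (hx : ∀ t < T, ‖x (t + 1)‖ ≤ 1) :
    regret θ T x ≤ 2 * T := by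
  refine (regret_le_of_forall (f := fun _ => 2) fun y hy t ht =>
    inner_sub_inner_le_two hθ hy (hx t ht)).trans (le_of_eq ?_)
  simp [mul_comm]

lemma sigmaBar_sq_le (σ : ℕ → ℝ) (t : ℕ) : sigmaBar d σ t ^ 2 ≤ 1 / d + σ t ^ 2 := by
  have h : (1 / Real.sqrt d) ^ 2 = 1 / d := by
    rw [div_pow, one_pow, Real.sq_sqrt (Nat.cast_nonneg d)]
  have h0 : (0 : ℝ) ≤ 1 / d := by positivity
  rcases max_choice (1 / Real.sqrt d) (σ t) with h1 | h1
  · rw [sigmaBar, h1, h]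
    linarith [sq_nonneg (σ t)]
  · rw [sigmaBar, h1]
    linarith

lemma regret_le (hd : 1 ≤ d) {δ : ℝ} {σ r : ℕ → ℝ}
    {x : ℕ → EuclideanSpace ℝ (Fin d)} {T : ℕ} {θ : EuclideanSpace ℝ (Fin d)} (hθ : ‖θ‖ ≤ 1)
    (hrun : IsRun 1 1 δ T σ r x) (hconf : ∀ t < T, θ ∈ confidenceSet 1 1 δ σ r x t)
    {β : ℝ} (hβ0 : 0 ≤ β) (hβ : ∀ t < T, radius d 1 δ σ t ≤ β) :
    regret θ T x ≤ 4 * (d * Real.log (1 + T)) + 2 * (β + 1) *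
      (Real.sqrt (T / d + ∑ t ∈ Finset.Icc 1 T, σ t ^ 2) *
        Real.sqrt (2 * (d * Real.log (1 + T)))) := by
  have hx : ∀ t < T, ‖x (t + 1)‖ ≤ 1 := fun t ht => (hrun t ht).1
  set q : ℕ → ℝ := fun t => invForm (gram 1 σ x t) (scaledAction σ x (t + 1))
        (scaledAction σ x (t + 1)) with hq
  have hq0 : ∀ t, 0 ≤ q t := fun t => invForm_nonneg (gram_posDef σ x t) _
  have hs0 : ∀ t, 0 < sigmaBar d σ t := sigmaBar_pos hd σ
  have hqx : ∀ t, Real.sqrt (invForm (gram 1 σ x t) (x (t + 1)).ofLp (x (t + 1)).ofLp)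
      = sigmaBar d σ (t + 1) * Real.sqrt (q t) := by
    intro t
    have e : (x (t + 1)).ofLp = sigmaBar d σ (t + 1) • scaledAction σ x (t + 1) := by
      rw [scaledAction, smul_smul, mul_one_div_cancel (hs0 _).ne', one_smul]
    have e2 : invForm (gram 1 σ x t) (x (t + 1)).ofLp (x (t + 1)).ofLp
        = sigmaBar d σ (t + 1) ^ 2 * q t := by
      simp only [e, hq, invForm, mulVec_smul, dotProduct_smul, smul_dotProduct, smul_eq_mul]
      ring
    rw [e2, Real.sqrt_mul (sq_nonneg _), Real.sqrt_sq (hs0 (t + 1)).le]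
  have hsum := sum_min_invForm_le hd σ x T hx
  refine (regret_le_of_forall (f := fun t => 2 * min 1 (q t)
    + 2 * (β + 1) * (sigmaBar d σ (t + 1) * Real.sqrt (min 1 (q t)))) fun y hy t ht => ?_).trans ?_
  · have hpos : 0 ≤ 2 * (β + 1) * (sigmaBar d σ (t + 1) * Real.sqrt (min 1 (q t))) := by
      have := (hs0 (t + 1)).le
      positivity
    -- Rounds with `q t ≥ 1` are charged their trivial regret `2 = 2 min(1, q)`; the others use
    -- optimism.
    rcases le_total 1 (q t) with h1 | h1
    · have := inner_sub_inner_le_two hθ hy (hx t ht)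
      have e : min 1 (q t) = 1 := min_eq_left h1
      rw [e] at hpos ⊢
      linarith
    · rw [min_eq_right h1]
      have h2 := inner_le_of_isMaxOn (hconf t ht) (hrun t ht).2 hy
      rw [hqx] at h2
      have h3 : 2 * (radius d 1 δ σ t + 1) * (sigmaBar d σ (t + 1) * Real.sqrt (q t))
          ≤ 2 * (β + 1) * (sigmaBar d σ (t + 1) * Real.sqrt (q t)) := by
        have := (hs0 (t + 1)).le
        gcongr
        exact hβ t ht
      linarith [hq0 t]
  · rw [Finset.sum_add_distrib, ← Finset.mul_sum, ← Finset.mul_sum]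
    have hcs : ∑ t ∈ Finset.range T, sigmaBar d σ (t + 1) * Real.sqrt (min 1 (q t))
        ≤ Real.sqrt (∑ t ∈ Finset.range T, sigmaBar d σ (t + 1) ^ 2)
          * Real.sqrt (∑ t ∈ Finset.range T, min 1 (q t)) := by
      refine (Real.sum_mul_le_sqrt_mul_sqrt _ _ _).trans (le_of_eq ?_)
      congr 2
      exact Finset.sum_congr rfl fun t _ => Real.sq_sqrt (le_min zero_le_one (hq0 t))
    have hsig : ∑ t ∈ Finset.range T, sigmaBar d σ (t + 1) ^ 2
        ≤ T / d + ∑ t ∈ Finset.Icc 1 T, σ t ^ 2 := by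
      rw [sum_Icc_one_eq_sum_range]
      refine (Finset.sum_le_sum fun t _ => sigmaBar_sq_le σ (t + 1)).trans (le_of_eq ?_)
      rw [Finset.sum_add_distrib]
      simp [div_eq_mul_inv]
    have hcs2 := hcs.trans (mul_le_mul (Real.sqrt_le_sqrt hsig) (Real.sqrt_le_sqrt hsum)
      (Real.sqrt_nonneg _) (Real.sqrt_nonneg _))
    have h2 := mul_le_mul_of_nonneg_left hcs2 (show 0 ≤ 2 * (β + 1) by linarith)
    linarith

end Regret

/-! ### The final bound -/

section FinalBound

/-- Since `κ² a ≥ 1`, placing `a` under the root costs only a factor `κ`. -/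
lemma le_mul_sqrt {D N M a κ : ℝ} (hDN : 0 ≤ D * N) (hM : M ^ 2 ≤ D * N) (hκ : 1 ≤ κ)
    (hκa : 1 ≤ κ * a) : M ≤ κ * Real.sqrt (D * N * a) := by
  have e : κ * Real.sqrt (D * N * a) = Real.sqrt (κ ^ 2 * (D * N * a)) := by
    rw [Real.sqrt_mul (sq_nonneg _), Real.sqrt_sq (by linarith)]
  rw [e]
  refine Real.le_sqrt_of_sq_le (hM.trans ?_)
  calc D * N ≤ D * N * (κ * (κ * a)) := le_mul_of_one_le_right hDN (by nlinarith)
    _ = _ := by ring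

lemma two_mul_le_bound {D N a κ Γ V : ℝ} (hD : 0 < D) (hN : 0 ≤ N) (hND : N ≤ D)
    (hκ : 1 ≤ κ) (hκa : 1 ≤ κ * a) (hΓ : 1 ≤ Γ) :
    2 * N ≤ 40 * κ * Γ ^ 2 * (Real.sqrt (D * N * a) + D * Real.sqrt (V * a)) := by
  have h1 : N ≤ κ * Real.sqrt (D * N * a) :=
    le_mul_sqrt (by positivity) (by nlinarith) hκ hκa
  have h2 : 0 ≤ D * Real.sqrt (V * a) := by positivity
  have h3 : 1 ≤ Γ ^ 2 := one_le_pow₀ hΓ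
  have hκ0 : 0 ≤ κ := by linarith
  have h4 : 0 ≤ κ * Real.sqrt (D * N * a) := by positivity
  have h5 : 0 ≤ κ * (D * Real.sqrt (V * a)) := by positivity
  nlinarith [mul_nonneg (sub_nonneg.2 h3) h4, mul_nonneg (sub_nonneg.2 h3) h5]

/-- The letters stand for `d`, `T`, `log (1/δ)`, `1 + 1 / log (1/δ₀)`, the logarithmic factor, `∑
σ_t²`, `log (1 + T)` and `log (4 T² / δ)`. The constant `40` is `4 + 36`, from the two summands. -/
lemma final_bound_le {D N a κ Γ V L l : ℝ} (hD : 1 ≤ D) (hDN : D ≤ N) (ha : 0 ≤ a)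
    (hV : 0 ≤ V) (hκ : 1 ≤ κ) (hκa : 1 + a ≤ κ * a) (hΓ : 1 ≤ Γ) (hL0 : 0 ≤ L) (hL : L ≤ Γ)
    (hl : l ≤ 2 * Γ + a) :
    4 * (D * L) + 2 * (8 * Real.sqrt (D * L * l) + 1) *
        (Real.sqrt (N / D + V) * Real.sqrt (2 * (D * L)))
      ≤ 40 * κ * Γ ^ 2 * (Real.sqrt (D * N * a) + D * Real.sqrt (V * a)) := by
  have hD0 : 0 < D := by linarith
  have hN0 : 0 < N := by linarith
  have hκ0 : 0 < κ := by linarith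
  have hΓ0 : 0 < Γ := by linarith
  set R := Real.sqrt (2 * D * (κ * a)) with hR
  set Y := Real.sqrt (D * N * a) + D * Real.sqrt (V * a) with hY
  have hY0 : 0 ≤ Y := by positivity
  have hR1 : 1 ≤ R := Real.one_le_sqrt.2 (by nlinarith)
  have hβ : Real.sqrt (D * L * l) ≤ Γ * R := by
    have e : Γ * R = Real.sqrt (Γ ^ 2 * (2 * D * (κ * a))) := by
      rw [Real.sqrt_mul (sq_nonneg _), Real.sqrt_sq (by linarith)]
    rw [e]
    refine Real.sqrt_le_sqrt ?_
    calc D * L * l ≤ D * L * (2 * Γ * (κ * a)) := by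
          gcongr
          nlinarith
      _ ≤ D * Γ * (2 * Γ * (κ * a)) := by
          have : 0 ≤ κ * a := by linarith
          gcongr
      _ = _ := by ring
  have hG : 8 * Real.sqrt (D * L * l) + 1 ≤ 9 * (Γ * R) := by nlinarith
  have hprod : R * (Real.sqrt (N / D + V) * Real.sqrt (2 * (D * L))) ≤ 2 * (Γ * κ) * Y := by
    rw [hR, ← Real.sqrt_mul (by positivity), ← Real.sqrt_mul (by positivity)]
    have e : Real.sqrt (4 * (Γ * κ) ^ 2) = 2 * (Γ * κ) := by
      rw [show 4 * (Γ * κ) ^ 2 = (2 * (Γ * κ)) ^ 2 by ring, Real.sqrt_sq (by positivity)]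
    have hY2 : Real.sqrt (D * N * a + D ^ 2 * (V * a)) ≤ Y := by
      have h1 : D * Real.sqrt (V * a) = Real.sqrt (D ^ 2 * (V * a)) := by
        rw [Real.sqrt_mul (sq_nonneg D), Real.sqrt_sq hD0.le]
      rw [hY, h1]
      refine Real.sqrt_le_iff.2 ⟨by positivity, ?_⟩
      rw [add_sq, Real.sq_sqrt (by positivity), Real.sq_sqrt (by positivity)]
      have : 0 ≤ 2 * Real.sqrt (D * N * a) * Real.sqrt (D ^ 2 * (V * a)) := by positivity
      linarith
    refine le_trans ?_ (mul_le_mul_of_nonneg_left hY2 (by positivity))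
    rw [← e, ← Real.sqrt_mul (by positivity)]
    refine Real.sqrt_le_sqrt ?_
    have hNV : 0 ≤ D * N * a + D ^ 2 * (V * a) := by positivity
    calc 2 * D * (κ * a) * ((N / D + V) * (2 * (D * L)))
        = 4 * (L * κ) * (D * N * a + D ^ 2 * (V * a)) := by field_simp; ring
      _ ≤ 4 * (Γ * κ) * (D * N * a + D ^ 2 * (V * a)) := by gcongr
      _ ≤ 4 * (Γ * κ) ^ 2 * (D * N * a + D ^ 2 * (V * a)) := by
          gcongr
          have : 1 ≤ Γ * κ := by nlinarith
          nlinarith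
  have hDY : D ≤ κ * Y := by
    have h1 : D ≤ κ * Real.sqrt (D * N * a) :=
      le_mul_sqrt (by positivity) (by nlinarith) hκ (by linarith)
    have h2 : 0 ≤ κ * (D * Real.sqrt (V * a)) := by positivity
    rw [hY, mul_add]
    linarith
  have h1 : 4 * (D * L) ≤ 4 * κ * Γ ^ 2 * Y := by
    calc 4 * (D * L) ≤ 4 * (κ * Y * Γ) := by gcongr
      _ ≤ 4 * (κ * Y * Γ ^ 2) := by
        gcongr
        nlinarith
      _ = _ := by ring
  have h2 : 2 * (8 * Real.sqrt (D * L * l) + 1) *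
      (Real.sqrt (N / D + V) * Real.sqrt (2 * (D * L))) ≤ 36 * κ * Γ ^ 2 * Y := by
    calc _ ≤ 2 * (9 * (Γ * R)) * (Real.sqrt (N / D + V) * Real.sqrt (2 * (D * L))) := by gcongr
      _ = 18 * Γ * (R * (Real.sqrt (N / D + V) * Real.sqrt (2 * (D * L)))) := by ring
      _ ≤ 18 * Γ * (2 * (Γ * κ) * Y) := by gcongr
      _ = _ := by ring
  linarith

end FinalBound

/-! ### Assembling the regret bound -/

section Main

variable {d : ℕ} {Ω : Type*} {mΩ : MeasurableSpace Ω} {T : ℕ}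
  {x : ℕ → Ω → EuclideanSpace ℝ (Fin d)} {η σ r : ℕ → Ω → ℝ} {θ : EuclideanSpace ℝ (Fin d)}

lemma mem_confidenceSet_of_sqrt_invForm_le (hθ : ‖θ‖ ≤ 1) {δ : ℝ} {ω : Ω}
    (hr : ∀ t < T, r (t + 1) ω = inner ℝ (x (t + 1) ω) θ + η (t + 1) ω)
    (h : ∀ t < T, Real.sqrt (invForm (gramRV x σ (t + 1) ω) (noiseSum x η σ (t + 1) ω).ofLp
      (noiseSum x η σ (t + 1) ω).ofLp) ≤ radius d 1 δ (fun s => σ s ω) (t + 1))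
    {t : ℕ} (ht : t < T) :
    θ ∈ confidenceSet 1 1 δ (fun s => σ s ω) (fun s => r s ω) (fun s => x s ω) t := by
  change matNorm _ _ ≤ _
  refine (matNorm_sub_estimator_le (fun s => σ s ω) (fun s => r s ω) (fun s => η s ω)
    (fun s => x s ω) θ t (fun s hs => hr s (by omega))).trans ?_
  rw [Real.sqrt_one, mul_one]
  refine add_le_add ?_ hθ
  cases t with
  | zero => simp [response, invForm, radius]
  | succ t => exact h t (by omega)

/-- The regret bound on the confidence event. -/
lemma regret_le_of_confidence (hd : 1 ≤ d) (hT : 1 ≤ T) {δ₀ δ : ℝ} (hδ₀ : δ₀ < 1) (hδ : 0 < δ)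
    (hδδ₀ : δ ≤ δ₀) (hθ : ‖θ‖ ≤ 1) {σ r : ℕ → ℝ} {x : ℕ → EuclideanSpace ℝ (Fin d)}
    (hrun : IsRun 1 1 δ T σ r x) (hconf : ∀ t < T, θ ∈ confidenceSet 1 1 δ σ r x t) :
    regret θ T x ≤ 40 * (1 + 1 / Real.log (1 / δ₀)) *
      (1 + Real.log T + Real.log d + Real.log (1 + Real.log (1 / δ))) ^ 2 *
      (Real.sqrt (d * T * Real.log (1 / δ))
        + d * Real.sqrt (∑ t ∈ Finset.Icc 1 T, σ t ^ 2 * Real.log (1 / δ))) := by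
  have hd1 : (1 : ℝ) ≤ d := by exact_mod_cast hd
  have hT1 : (1 : ℝ) ≤ T := by exact_mod_cast hT
  have hlogd : 0 ≤ Real.log d := Real.log_nonneg hd1
  have hlogT : 0 ≤ Real.log T := Real.log_nonneg hT1
  have hδ₀0 : 0 < δ₀ := hδ.trans_le hδδ₀
  have ha₀ : 0 < Real.log (1 / δ₀) := Real.log_pos (by rw [lt_div_iff₀ hδ₀0]; linarith)
  have haa₀ : Real.log (1 / δ₀) ≤ Real.log (1 / δ) :=
    Real.log_le_log (by positivity) (one_div_le_one_div_of_le hδ hδδ₀)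
  set a₀ := Real.log (1 / δ₀) with ha₀d
  set a := Real.log (1 / δ) with had
  have ha : 0 < a := ha₀.trans_le haa₀
  have hloga : 0 ≤ Real.log (1 + a) := Real.log_nonneg (by linarith)
  set κ := 1 + 1 / a₀ with hκd
  set Γ := 1 + Real.log T + Real.log d + Real.log (1 + a) with hΓd
  have hκ : 1 ≤ κ := by
    have : 0 ≤ 1 / a₀ := by positivity
    linarith
  have hκa : 1 + a ≤ κ * a := by
    have : 1 ≤ a / a₀ := (one_le_div ha₀).2 haa₀
    have e : κ * a = a + a / a₀ := by rw [hκd]; field_simp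
    linarith
  have hΓ : 1 ≤ Γ := by linarith
  rw [← Finset.sum_mul]
  rcases le_total (T : ℝ) d with h | h
  · exact (regret_le_two_mul hθ fun t ht => (hrun t ht).1).trans
      (two_mul_le_bound (by linarith) (by linarith) h hκ (by linarith) hΓ)
  · have hlog2 := Real.log_two_lt_d9
    refine (regret_le hd hθ hrun hconf (mul_nonneg (by norm_num) (Real.sqrt_nonneg _))
      fun t ht => radius_le hd hδ (by linarith) σ ht.le).trans
      (final_bound_le hd1 h ha.le (Finset.sum_nonneg fun _ _ => sq_nonneg _) hκ hκa hΓ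
        (Real.log_nonneg (by linarith)) ?_ ?_)
    · have h1 : Real.log (1 + T) ≤ Real.log (2 * T) :=
        Real.log_le_log (by linarith) (by linarith)
      rw [Real.log_mul (by norm_num) (by linarith)] at h1
      linarith
    · have e : Real.log (4 * (T : ℝ) ^ 2 / δ) = 2 * Real.log 2 + 2 * Real.log T + a := by
        rw [show 4 * (T : ℝ) ^ 2 / δ = (2 * T) ^ 2 * (1 / δ) by ring,
          Real.log_mul (by positivity) (by positivity), Real.log_pow,
          Real.log_mul (by norm_num) (by linarith)]
        push_cast
        ring
      rw [e]
      linarith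

end Main

end WeightedOFUL

theorem mainTheorem5 :
    ∃ p : ℕ, ∀ δ₀ : ℝ, 0 < δ₀ → δ₀ < 1 → ∃ K : ℝ, 0 < K ∧
      ∀ (d T : ℕ), 1 ≤ d → 1 ≤ T → ∀ δ : ℝ, 0 < δ → δ ≤ δ₀ →
      ∀ {Ω : Type*} {mΩ : MeasurableSpace Ω} (μ : Measure Ω) [IsProbabilityMeasure μ]
        (ℱ : Filtration ℕ mΩ) (θstar : EuclideanSpace ℝ (Fin d))
        (x : ℕ → Ω → EuclideanSpace ℝ (Fin d)) (η σ r : ℕ → Ω → ℝ),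
        ‖θstar‖ ≤ 1 →
        (∀ t < T, Measurable[ℱ t] (x (t + 1))) →
        (∀ t < T, Measurable[ℱ t] (σ (t + 1))) →
        (∀ t < T, ∀ ω, 0 ≤ σ (t + 1) ω) →
        (∀ t < T, Measurable[ℱ (t + 1)] (η (t + 1))) →
        (∀ t < T, WeightedOFUL.CondSymmetric (ℱ t) μ (η (t + 1))) →
        (∀ t < T, WeightedOFUL.CondSubGaussian (ℱ t) μ (η (t + 1)) (σ (t + 1))) →
        (∀ t < T, ∀ ω, r (t + 1) ω = inner ℝ (x (t + 1) ω) θstar + η (t + 1) ω) →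
        (∀ ω, WeightedOFUL.IsRun 1 1 δ T (fun t => σ t ω) (fun t => r t ω) (fun t => x t ω)) →
        1 - δ ≤ μ.real {ω |
          WeightedOFUL.regret θstar T (fun t => x t ω)
            ≤ K * (1 + Real.log T + Real.log d + Real.log (1 + Real.log (1 / δ))) ^ p *
              (Real.sqrt (d * T * Real.log (1 / δ))
                + d * Real.sqrt (∑ t ∈ Finset.Icc 1 T, σ t ω ^ 2 * Real.log (1 / δ)))} := by
  refine ⟨2, fun δ₀ hδ₀ hδ₀1 => ⟨40 * (1 + 1 / Real.log (1 / δ₀)), ?_, ?_⟩⟩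
  · have : 0 < Real.log (1 / δ₀) := Real.log_pos (by rw [lt_div_iff₀ hδ₀]; linarith)
    positivity
  intro d T hd hT δ hδ hδδ₀ Ω mΩ μ _ ℱ θstar x η σ r hθ hx hσ hσ0 hη hsym hsub hr hrun
  have H : WeightedOFUL.IsInteraction T μ ℱ x η σ :=
    ⟨hx, fun t ht ω => (hrun ω t ht).1, hσ, hσ0, hη, hsym, hsub⟩
  obtain ⟨E, hE, hgood⟩ := H.exists_confidence_event hd hT hδ (by linarith)
  have hEr : μ.real E ≤ δ := ENNReal.toReal_le_of_le_ofReal hδ.le hE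
  set G := {ω | WeightedOFUL.regret θstar T (fun t => x t ω)
    ≤ 40 * (1 + 1 / Real.log (1 / δ₀)) *
      (1 + Real.log T + Real.log d + Real.log (1 + Real.log (1 / δ))) ^ 2 *
      (Real.sqrt (d * T * Real.log (1 / δ))
        + d * Real.sqrt (∑ t ∈ Finset.Icc 1 T, σ t ω ^ 2 * Real.log (1 / δ)))} with hG
  -- Covering the space and using subadditivity avoids any measurability of `G` or `E`.
  have hcover : (Set.univ : Set Ω) ⊆ G ∪ E := by
    intro ω _
    by_cases hω : ω ∈ E
    · exact Or.inr hω
    · exact Or.inl (WeightedOFUL.regret_le_of_confidence hd hT hδ₀1 hδ hδδ₀ hθ (hrun ω)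
        fun t ht => WeightedOFUL.mem_confidenceSet_of_sqrt_invForm_le hθ
          (fun s hs => hr s hs ω) (hgood ω hω) ht)
  have h1 : μ.real Set.univ ≤ μ.real G + μ.real E :=
    (measureReal_mono hcover).trans (measureReal_union_le _ _)
  rw [probReal_univ] at h1
  linarith
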